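/- Let $m=(m_0,m_1,\dots)$ be a bounded sequence of integers $m_k\ge 2$, let $G_m=\prod_{k\ge0}\mathbb{Z}/m_k\mathbb{Z}$ be the corresponding (bounded) Vilenkin group and $\mu$ its normalized Haar measure (the product of the uniform probability measures). Put $M_0=1$, $M_{k+1}=m_kM_k$, write each $n\in\mathbb N=\{0,1,\dots\}$ uniquely as $n=\sum_k n_kM_k$ with $0\le n_k<m_k$, and let $\psi_n(x)=\prod_{k}\exp(2\pi i x_k/m_k)^{n_k}$ be the Vilenkin system. Let $\mathcal F_n$ be the $\sigma$-algebra generated by the sets $I_n(x)=\{y: y_0=x_0,\dots,y_{n-1}=x_{n-1}\}$, $x\in G_m$. For $0<p<\infty$, the Hardy space $H_p$ consists of the (complex-valued) martingales $f=(f^{(n)})_{n\in\mathbb N}$ with respect to $(\mathcal F_n)$ such that $$\|f\|_{H_p}:=\Big(\int_{G_m}\sup_{n}|f^{(n)}|^p\,d\mu\Big)^{1/p}<\infty ,$$ and $\|g\|_{\text{weak-}L_p}:=\sup_{t>0}t\,\mu(|g|>t)^{1/p}$. For a martingale $f$ let $\widehat f(i)=\lim_{k\to\infty}\int_{G_m}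 f^{(k)}\overline{\psi_i}\,d\mu$ and $S_nf=\sum_{k=0}^{n-1}\widehat f(k)\psi_k$. For a sequence $(q_k)_{k\ge0}$ of non-negative numbers with $q_0>0$ put, for $n\ge 1$, $$Q_n=\sum_{k=0}^{n-1}q_k,\qquad T_nf=\frac1{Q_n}\sum_{k=0}^{n-1}q_kS_kf,\qquad T^*f=\sup_{n\ge1}|T_nf| .$$ (a) If $(q_k)$ is non-decreasing and $q_{n-1}/Q_n=O(1/n)$ as $n\to\infty$, then $T^*$ is bounded from $H_{1/2}$ to weak-$L_{1/2}$: there is a constant $c$ (depending only on $m$ and $(q_k)$) such that $\|T^*f\|_{\text{weak-}L_{1/2}}\le c\,\|f\|_{H_{1/2}}$ for all $f\in H_{1/2}$. (b) Let $0<p<1/2$. For every non-decreasing sequence $(q_k)$ there is a martingale $f\in H_p$ such that $\sup_{n\ge1}\|T_nf\|_{\text{weak-}L_p}=\infty$. -/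

import Mathlib

open MeasureTheory Filter Asymptotics
open scoped ENNReal NNReal

noncomputable section

namespace Vilenkin

/-- The Vilenkin group `G_m`, the complete direct product of the cyclic groups `ℤ/m_k`. -/
abbrev VGroup (m : ℕ → ℕ) : Type := (k : ℕ) → ZMod (m k)

/-- The product of the uniform probability measures on the factors, i.e. the normalized
Haar measure on `G_m`. -/
def haar (m : ℕ → ℕ) [∀ k, NeZero (m k)] : Measure (VGroup m) :=
  Measure.infinitePi fun k => (PMF.uniformOfFintype (ZMod (m k))).toMeasure

/-- The interval `I_n(x)` of all `y` with `y_0 = x_0, …, y_{n-1} = x_{n-1}`. -/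
def interval (m : ℕ → ℕ) (n : ℕ) (x : VGroup m) : Set (VGroup m) :=
  {y | ∀ k < n, y k = x k}

theorem measurableSet_interval (m : ℕ → ℕ) (n : ℕ) (x : VGroup m) :
    MeasurableSet (interval m n x) := by
  have h : interval m n x = ⋂ k ∈ Set.Iio n, (fun y : VGroup m => y k) ⁻¹' {x k} := by
    ext y; simp [interval]
  rw [h]
  exact MeasurableSet.biInter (Set.to_countable _)
    fun k _ => measurable_pi_apply k (measurableSet_singleton _)

theorem interval_eq_iUnion (m : ℕ → ℕ) (n : ℕ) (x : VGroup m) :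
    interval m n x = ⋃ a : ZMod (m n), interval m (n + 1) (Function.update x n a) := by
  ext y
  simp only [interval, Set.mem_ofPred_eq, Set.mem_iUnion]
  constructor
  · intro h
    refine ⟨y n, fun k hk => ?_⟩
    rcases eq_or_ne k n with rfl | hne
    · simp
    · rw [Function.update_of_ne hne]
      exact h k (by omega)
  · rintro ⟨a, ha⟩ k hk
    have := ha k (by omega)
    rwa [Function.update_of_ne (by omega)] at this

/-- The filtration whose `n`-th σ-algebra is generated by the intervals `I_n(x)`, `x ∈ G_m`. -/
def filtration (m : ℕ → ℕ) [∀ k, NeZero (m k)] :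
    Filtration ℕ (MeasurableSpace.pi : MeasurableSpace (VGroup m)) where
  seq n := MeasurableSpace.generateFrom (Set.range (interval m n))
  mono' := by
    refine monotone_nat_of_le_succ fun n => MeasurableSpace.generateFrom_le ?_
    rintro _ ⟨x, rfl⟩
    rw [interval_eq_iUnion]
    exact MeasurableSet.iUnion fun a => MeasurableSpace.measurableSet_generateFrom ⟨_, rfl⟩
  le' n := by
    refine MeasurableSpace.generateFrom_le ?_
    rintro _ ⟨x, rfl⟩
    exact measurableSet_interval m n x

/-- The generalized powers `M_0 = 1`, `M_{k+1} = m_k M_k`. -/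
def M (m : ℕ → ℕ) (k : ℕ) : ℕ := ∏ j ∈ Finset.range k, m j

/-- The `k`-th digit `n_k ∈ {0, …, m_k - 1}` of `n = ∑ n_k M_k`. -/
def digit (m : ℕ → ℕ) (n k : ℕ) : ℕ := n / M m k % m k

/-- All digits of `n` from the `n`-th on vanish. -/
theorem digit_eq_zero (m : ℕ → ℕ) (hm : ∀ k, 2 ≤ m k) {n k : ℕ} (h : n ≤ k) :
    digit m n k = 0 := by
  have h1 : 2 ^ k ≤ M m k := by
    simpa [M] using Finset.prod_le_prod' (s := Finset.range k) (f := fun _ => 2) (g := m)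
      fun i _ => hm i
  have h2 : n < M m k := lt_of_le_of_lt h (lt_of_lt_of_le Nat.lt_two_pow_self h1)
  simp [digit, Nat.div_eq_of_lt h2]

/-- The generalized Rademacher functions `r_k(x) = exp(2πi x_k / m_k)`. -/
def rademacher (m : ℕ → ℕ) (k : ℕ) (x : VGroup m) : ℂ :=
  Complex.exp (2 * Real.pi * Complex.I * ((x k).val : ℂ) / (m k : ℂ))

/-- The Vilenkin functions `ψ_n = ∏_k r_k ^ n_k`; when all `m_k ≥ 2` the factors with `k ≥ n`
are `1` by `digit_eq_zero`. -/
def psi (m : ℕ → ℕ) (n : ℕ) (x : VGroup m) : ℂ :=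
  ∏ k ∈ Finset.range n, rademacher m k x ^ digit m n k

section

variable (m : ℕ → ℕ) [∀ k, NeZero (m k)]

/-- The (quasi-)norm `‖f^*‖_p`, `f^* = sup_n |f^(n)|`, in `[0, ∞]`. -/
def hardyNorm (p : ℝ) (f : ℕ → VGroup m → ℂ) : ℝ≥0∞ :=
  (∫⁻ x, (⨆ n, ‖f n x‖ₑ) ^ p ∂haar m) ^ (1 / p)

/-- `f` is a martingale in the Hardy space `H_p(G_m)`. -/
def MemHardy (p : ℝ) (f : ℕ → VGroup m → ℂ) : Prop :=
  Martingale f (filtration m) (haar m) ∧ hardyNorm m p f < ∞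

/-- The weak-`L_p` (quasi-)norm `(sup_{t > 0} t^p μ(g > t))^{1/p}` of a function
with values in `[0, ∞]`. -/
def weakNorm (p : ℝ) (g : VGroup m → ℝ≥0∞) : ℝ≥0∞ :=
  (⨆ (t : ℝ≥0) (_ : 0 < t), (t : ℝ≥0∞) ^ p * haar m {x | (t : ℝ≥0∞) < g x}) ^ (1 / p)

/-- The Vilenkin–Fourier coefficient `lim_k ∫ f^(k) conj ψ_i dμ` of a martingale. -/
def fourierCoeff (f : ℕ → VGroup m → ℂ) (i : ℕ) : ℂ :=
  limUnder atTop fun k => ∫ x, f k x * (starRingEnd ℂ) (psi m i x) ∂haar m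

/-- The partial sums `S_n f = ∑_{k < n} f̂(k) ψ_k`. -/
def partialSum (f : ℕ → VGroup m → ℂ) (n : ℕ) (x : VGroup m) : ℂ :=
  ∑ k ∈ Finset.range n, fourierCoeff m f k * psi m k x

/-- `Q_n = q_0 + ⋯ + q_{n-1}`. -/
def Q (q : ℕ → ℝ) (n : ℕ) : ℝ := ∑ k ∈ Finset.range n, q k

/-- The `T` means `T_n f = Q_n⁻¹ ∑_{k < n} q_k S_k f` (with `T_0 f = 0`). -/
def tMean (q : ℕ → ℝ) (f : ℕ → VGroup m → ℂ) (n : ℕ) (x : VGroup m) : ℂ :=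
  ((Q q n : ℝ) : ℂ)⁻¹ * ∑ k ∈ Finset.range n, (q k : ℂ) * partialSum m f k x

/-- The maximal operator `T^* f = sup_n |T_n f|`. -/
def tMax (q : ℕ → ℝ) (f : ℕ → VGroup m → ℂ) (x : VGroup m) : ℝ≥0∞ :=
  ⨆ n, ‖tMean m q f n x‖ₑ

end

end Vilenkin

end

noncomputable section

set_option linter.unusedSectionVars false

namespace Vilenkin

/-! ### Measure, σ-algebras and martingales in terms of coordinates -/

section Basic

variable {m : ℕ → ℕ} [∀ k, NeZero (m k)]

/-! Part (a) reduces to Fejér means. Summation by parts writes `Q_n T_n f` through the sums `∑_{k<j}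
S_k f`, with coefficients `q_{j+1} - q_j ≥ 0` that telescope by monotonicity. Since `n q_{n-1} /
Q_n` is bounded, a bound `|∑_{k<j} S_k f| ≤ j B` for all `j ≤ n` yields `|T_n f| ≤ C B`
(`norm_sum_mul_le`, `exists_mul_le_Q`).

The Fejér kernels are dominated by sums of the heights `M_s M_B` on the sets where all coordinates
before the `B`-th vanish, except possibly the `s`-th (`norm_fejerSum_le`). Integrating this majorant
shows that Fejér means are bounded on bounded functions. For an atom, that is a function bounded by
`h²`, supported on `I_N(u)` and annihilated by the Fejér sums of index at most `M_N`, all Fejér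
means lie below one `envelope`, and `r μ(envelope > r²) = O(h / M_N)` uniformly in `r`
(`haar_envelope_le`).

Stopping the martingale when its predictable majorant exceeds the levels `(δ 2^k)²`, with `δ` at
least `∫ (f^*)^{1/2}`, splits it into a part bounded by `3 δ²` and atoms with `h = 4 δ 2^k`. The
intervals carrying the atoms of level `k` have total measure at most `b μ(f^* > (δ 2^k)²)`, where
`b` bounds the `m_k`, and these measures weighted by `δ 2^k` sum to at most `2 b ∫ (f^*)^{1/2}`. The
atoms are reassembled by `weak_half_sum_le`: because `1/2 < 1`, the quantities `sup_r r μ(g > r²)`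
are additive up to a factor independent of the number of summands.

For part (b), take a martingale whose Fourier coefficients equal `w_A` on each block `[M_A,
M_{A+1})`, with `w` carried by a sparse sequence of blocks. In `T_{M_A+2}` the block `A` enters only
through the single term `w_A ψ_{M_A}` of `S_{M_A+1}`. This term has constant modulus, and
monotonicity of `q` gives it weight at least `1/(3 M_A)`. Membership in `H_p` permits `w_A` of order
`M_A^{1/p-1}` up to a factor summable along the sequence, and `M_A^{1/p-2}` is unbounded because `p
< 1/2`. Sparseness makes the earlier blocks negligible. -/

theorem M_zero : M m 0 = 1 := by simp [M]

theorem M_succ (n : ℕ) : M m (n + 1) = M m n * m n := by simp [M, Finset.prod_range_succ]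

theorem M_pos (n : ℕ) : 0 < M m n :=
  Finset.prod_pos fun k _ => Nat.pos_of_ne_zero (NeZero.ne (m k))

theorem M_mono : Monotone (M m) := by
  refine monotone_nat_of_le_succ fun n => ?_
  rw [M_succ]
  exact Nat.le_mul_of_pos_right _ (Nat.pos_of_ne_zero (NeZero.ne (m n)))

theorem two_mul_M_le (hm : ∀ k, 2 ≤ m k) (n : ℕ) : 2 * M m n ≤ M m (n + 1) := by
  rw [M_succ, mul_comm]
  exact Nat.mul_le_mul_left _ (hm n)

theorem two_pow_le_M (hm : ∀ k, 2 ≤ m k) (n : ℕ) : 2 ^ n ≤ M m n := by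
  induction n with
  | zero => simp [M_zero]
  | succ n ih =>
    rw [pow_succ]
    have := two_mul_M_le hm n
    omega

theorem lt_M_self (hm : ∀ k, 2 ≤ m k) (n : ℕ) : n < M m n :=
  lt_of_lt_of_le Nat.lt_two_pow_self (two_pow_le_M hm n)

theorem sum_M_le (hm : ∀ k, 2 ≤ m k) (n : ℕ) :
    ∑ k ∈ Finset.range (n + 1), (M m k : ℝ) ≤ 2 * M m n := by
  induction n with
  | zero => simp [M_zero]
  | succ n ih =>
    rw [Finset.sum_range_succ]
    have : (2 * M m n : ℝ) ≤ M m (n + 1) := by exact_mod_cast two_mul_M_le hm n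
    linarith

theorem M_strictMono (hm : ∀ k, 2 ≤ m k) : StrictMono (M m) := by
  refine strictMono_nat_of_lt_succ fun n => ?_
  have := two_mul_M_le hm n
  have := M_pos (m := m) n
  omega

theorem exists_M_le_lt (hm : ∀ k, 2 ≤ m k) {n : ℕ} (hn : 1 ≤ n) :
    ∃ A, M m A ≤ n ∧ n < M m (A + 1) := by
  have hex : ∃ B, n < M m B := ⟨n, lt_M_self hm n⟩
  classical
  set B := Nat.find hex with hB
  have h1 : n < M m B := Nat.find_spec hex
  have h0 : B ≠ 0 := by
    intro h
    rw [h, M_zero] at h1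
    omega
  obtain ⟨A, hA⟩ := Nat.exists_eq_succ_of_ne_zero h0
  refine ⟨A, ?_, by rwa [hA] at h1⟩
  have := Nat.find_min hex (m := A) (by omega)
  omega

instance : IsProbabilityMeasure (haar m) := by
  unfold haar; infer_instance

theorem haar_interval (n : ℕ) (x : VGroup m) : haar m (interval m n x) = (M m n : ℝ≥0∞)⁻¹ := by
  have h : interval m n x = Set.pi (Finset.range n : Set ℕ) fun k => {x k} := by
    ext y; simp [interval, Set.mem_pi]
  rw [h, haar, Measure.infinitePi_pi _ (fun i _ => measurableSet_singleton _)]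
  have : ∀ k ∈ Finset.range n,
      (PMF.uniformOfFintype (ZMod (m k))).toMeasure {x k} = (m k : ℝ≥0∞)⁻¹ := by
    intro k _
    rw [PMF.toMeasure_apply_singleton _ _ (measurableSet_singleton _)]
    simp [ZMod.card]
  rw [Finset.prod_congr rfl this, M]
  push_cast
  rw [ENNReal.prod_inv_distrib]
  intro i _ j _ _
  right
  simp

theorem haar_real_interval (n : ℕ) (x : VGroup m) :
    (haar m).real (interval m n x) = (M m n : ℝ)⁻¹ := by
  simp [Measure.real, haar_interval]

/-- The point with prescribed first `n` coordinates and vanishing further coordinates. -/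
def extend {n : ℕ} (w : (j : Fin n) → ZMod (m j)) : VGroup m :=
  fun k => if h : k < n then w ⟨k, h⟩ else 0

/-- The first `n` coordinates of a point. -/
def prefixOf (n : ℕ) (x : VGroup m) : (j : Fin n) → ZMod (m j) := fun j => x j

theorem mem_interval_extend_iff {n : ℕ} {w : (j : Fin n) → ZMod (m j)} {x : VGroup m} :
    x ∈ interval m n (extend w) ↔ w = prefixOf n x := by
  constructor
  · intro h
    funext j
    have := h j j.2
    simp only [extend, j.2, dif_pos] at this
    exact this.symm
  · rintro rfl k hk
    simp [extend, hk, prefixOf]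

theorem iUnion_interval_extend (n : ℕ) :
    ⋃ w : (j : Fin n) → ZMod (m j), interval m n (extend w) = Set.univ := by
  ext x; simp [mem_interval_extend_iff]

theorem pairwise_disjoint_interval_extend (n : ℕ) :
    Pairwise (Function.onFun Disjoint fun w : (j : Fin n) → ZMod (m j) =>
      interval m n (extend w)) := by
  intro v w hvw
  refine Set.disjoint_left.2 fun x hv hw => hvw ?_
  rw [mem_interval_extend_iff] at hv hw
  rw [hv, hw]

theorem dependsOn_comp_extend {β : Type*} {n : ℕ} {g : VGroup m → β}
    (hg : DependsOn g (Set.Iio n)) (x : VGroup m) : g (extend (prefixOf n x)) = g x :=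
  hg fun k hk => by simp [extend, prefixOf, Set.mem_Iio.1 hk]

theorem dependsOn_mono {β : Type*} {n k : ℕ} (h : n ≤ k) {g : VGroup m → β}
    (hg : DependsOn g (Set.Iio n)) : DependsOn g (Set.Iio k) :=
  hg.mono (Set.Iio_subset_Iio h)

theorem finite_range_of_dependsOn {β : Type*} {n : ℕ} {g : VGroup m → β}
    (hg : DependsOn g (Set.Iio n)) : (Set.range g).Finite := by
  refine (Set.finite_range fun w : (j : Fin n) → ZMod (m j) => g (extend w)).subset ?_
  rintro _ ⟨x, rfl⟩
  exact ⟨prefixOf n x, dependsOn_comp_extend hg x⟩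

theorem measurable_of_dependsOn {β : Type*} [MeasurableSpace β] {n : ℕ} {g : VGroup m → β}
    (hg : DependsOn g (Set.Iio n)) : Measurable[filtration m n] g := by
  intro s _
  have : g ⁻¹' s = ⋃ w ∈ {w : (j : Fin n) → ZMod (m j) | g (extend w) ∈ s},
      interval m n (extend w) := by
    ext x
    simp only [Set.mem_preimage, Set.mem_iUnion, mem_interval_extend_iff, exists_prop]
    constructor
    · intro h
      exact ⟨prefixOf n x, by simpa [dependsOn_comp_extend hg x] using h, rfl⟩
    · rintro ⟨w, hw, rfl⟩
      simpa [dependsOn_comp_extend hg x] using hw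
  rw [this]
  exact MeasurableSet.biUnion (Set.to_countable _)
    fun w _ => MeasurableSpace.measurableSet_generateFrom ⟨_, rfl⟩

theorem measurable_of_dependsOn' {β : Type*} [MeasurableSpace β] {n : ℕ} {g : VGroup m → β}
    (hg : DependsOn g (Set.Iio n)) : Measurable g :=
  (measurable_of_dependsOn hg).mono ((filtration m).le n) le_rfl

/-- The property holds for the generating intervals and survives complements and countable unions.
Together with `measurable_of_dependsOn` it lets dependence on finitely many coordinates replace
measurability throughout. -/
theorem mem_iff_mem_of_measurableSet {n : ℕ} {s : Set (VGroup m)}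
    (hs : MeasurableSet[filtration m n] s) : DependsOn (· ∈ s) (Set.Iio n) := by
  refine MeasurableSpace.generateFrom_induction (Set.range (interval m n))
    (fun s _ => DependsOn (· ∈ s) (Set.Iio n)) ?_ ?_ ?_ ?_ s hs
  · rintro _ ⟨z, rfl⟩ _ x y hxy
    simp only [interval, Set.mem_ofPred_eq, eq_iff_iff]
    exact forall₂_congr fun k hk => by rw [hxy k hk]
  · intro x y _
    simp
  · intro t _ ih x y hxy
    simpa [not_iff_not] using ih hxy
  · intro t _ ih x y hxy
    simp only [Set.mem_iUnion, eq_iff_iff]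
    exact exists_congr fun i => iff_of_eq (ih i hxy)

theorem dependsOn_of_measurable {β : Type*} [MeasurableSpace β] [MeasurableSingletonClass β]
    {n : ℕ} {g : VGroup m → β} (hg : Measurable[filtration m n] g) :
    DependsOn g (Set.Iio n) := by
  intro x y hxy
  have h := mem_iff_mem_of_measurableSet (hg (measurableSet_singleton (g y))) hxy
  simpa using h

theorem integrable_of_dependsOn {n : ℕ} {g : VGroup m → ℂ} (hg : DependsOn g (Set.Iio n)) :
    Integrable g (haar m) := by
  obtain ⟨C, hC⟩ := ((finite_range_of_dependsOn hg).isBounded).exists_norm_le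
  exact Integrable.of_bound (measurable_of_dependsOn' hg).aestronglyMeasurable C
    (Eventually.of_forall fun x => hC _ ⟨x, rfl⟩)

theorem integral_eq_sum_interval (n : ℕ) {g : VGroup m → ℂ} (hg : Integrable g (haar m)) :
    ∫ x, g x ∂haar m =
      ∑ w : (j : Fin n) → ZMod (m j), ∫ x in interval m n (extend w), g x ∂haar m := by
  rw [← integral_iUnion_fintype (fun w => measurableSet_interval _ _ _)
    (pairwise_disjoint_interval_extend n) (fun _ => hg.integrableOn), iUnion_interval_extend,
    Measure.restrict_univ]

theorem setIntegral_interval_of_dependsOn {n : ℕ} {g : VGroup m → ℂ}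
    (hg : DependsOn g (Set.Iio n)) (x : VGroup m) :
    ∫ y in interval m n x, g y ∂haar m = (M m n : ℂ)⁻¹ * g x := by
  rw [setIntegral_congr_fun (measurableSet_interval m n x) (g := fun _ => g x)
    (fun y hy => hg fun k hk => hy k hk), setIntegral_const, haar_real_interval]
  simp

theorem setIntegral_interval_succ {n : ℕ} {g : VGroup m → ℂ}
    (hg : DependsOn g (Set.Iio (n + 1))) (x : VGroup m) :
    ∫ y in interval m n x, g y ∂haar m =
      (M m (n + 1) : ℂ)⁻¹ * ∑ a : ZMod (m n), g (Function.update x n a) := by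
  rw [interval_eq_iUnion, integral_iUnion_fintype (fun _ => measurableSet_interval _ _ _) ?_
    (fun _ => (integrable_of_dependsOn hg).integrableOn), Finset.mul_sum]
  · exact Finset.sum_congr rfl fun a _ => setIntegral_interval_of_dependsOn hg _
  · intro a b hab
    refine Set.disjoint_left.2 fun y ha hb => hab ?_
    have h1 := ha n (by omega)
    have h2 := hb n (by omega)
    simp only [Function.update_self] at h1 h2
    rw [← h1, h2]

theorem update_apply_of_lt {n k : ℕ} (h : k < n) (x : VGroup m) (a : ZMod (m n)) :
    Function.update x n a k = x k := Function.update_of_ne (by omega) _ _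

theorem dependsOn_update {β : Type*} {n : ℕ} {h : VGroup m → β} (hh : DependsOn h (Set.Iio n))
    (x : VGroup m) (a : ZMod (m n)) : h (Function.update x n a) = h x :=
  hh fun _ hk => update_apply_of_lt hk x a

/-- Integration over the `n`-th coordinate annihilates a function of mean zero in it. -/
theorem integral_mul_eq_zero {n : ℕ} {h d : VGroup m → ℂ} (hh : DependsOn h (Set.Iio n))
    (hd : DependsOn d (Set.Iio (n + 1)))
    (h0 : ∀ x, ∑ a : ZMod (m n), d (Function.update x n a) = 0) :
    ∫ x, h x * d x ∂haar m = 0 := by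
  have hhd : DependsOn (fun x => h x * d x) (Set.Iio (n + 1)) := fun x y hxy => by
    simp only [hd hxy, dependsOn_mono (Nat.le_succ n) hh hxy]
  rw [integral_eq_sum_interval n (integrable_of_dependsOn hhd)]
  refine Finset.sum_eq_zero fun w _ => ?_
  rw [setIntegral_interval_succ hhd]
  simp_rw [dependsOn_update hh, ← Finset.mul_sum, h0]
  simp

theorem Martingale.dependsOn {f : ℕ → VGroup m → ℂ} (hf : Martingale f (filtration m) (haar m))
    (n : ℕ) : DependsOn (f n) (Set.Iio n) :=
  dependsOn_of_measurable (hf.stronglyMeasurable n).measurable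

/-- Integrate the martingale identity over `I_n(x)`: there `f n` is constant, and `f (n + 1)` is
constant on each of the `m n` subintervals of equal measure. -/
theorem Martingale.sum_update {f : ℕ → VGroup m → ℂ}
    (hf : Martingale f (filtration m) (haar m)) (n : ℕ) (x : VGroup m) :
    ∑ a : ZMod (m n), f (n + 1) (Function.update x n a) = m n * f n x := by
  have h1 : ∫ y in interval m n x, f n y ∂haar m = ∫ y in interval m n x, f (n + 1) y ∂haar m :=
    hf.setIntegral_eq (Nat.le_succ n) (MeasurableSpace.measurableSet_generateFrom ⟨x, rfl⟩)
  rw [setIntegral_interval_of_dependsOn (Martingale.dependsOn hf n),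
    setIntegral_interval_succ (Martingale.dependsOn hf (n + 1)), M_succ] at h1
  have hM : (M m n : ℂ) ≠ 0 := by exact_mod_cast (M_pos n).ne'
  have hmn : (m n : ℂ) ≠ 0 := by exact_mod_cast NeZero.ne (m n)
  push_cast at h1
  field_simp at h1
  rw [mul_comm, h1]

theorem Martingale.sum_update_sub {f : ℕ → VGroup m → ℂ}
    (hf : Martingale f (filtration m) (haar m)) (n : ℕ) (x : VGroup m) :
    ∑ a : ZMod (m n), (f (n + 1) (Function.update x n a) - f n (Function.update x n a)) = 0 := by
  simp_rw [dependsOn_update (Martingale.dependsOn hf n)]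
  rw [Finset.sum_sub_distrib, Martingale.sum_update hf]
  simp [ZMod.card]

/-- Converse of `Martingale.sum_update_sub`: increments of mean zero in their last coordinate are
orthogonal to indicators of sets of `filtration m n`. -/
theorem martingale_of_dependsOn {f : ℕ → VGroup m → ℂ} (hf : ∀ n, DependsOn (f n) (Set.Iio n))
    (h0 : ∀ n x, ∑ a : ZMod (m n),
      (f (n + 1) (Function.update x n a) - f n (Function.update x n a)) = 0) :
    Martingale f (filtration m) (haar m) := by
  refine martingale_nat (fun n => (measurable_of_dependsOn (hf n)).stronglyMeasurable)
    (fun n => integrable_of_dependsOn (hf n)) fun n => ?_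
  refine ae_eq_condExp_of_forall_setIntegral_eq ((filtration m).le n)
    (integrable_of_dependsOn (hf (n + 1)))
    (fun s _ _ => (integrable_of_dependsOn (hf n)).integrableOn) (fun s hs _ => ?_)
    (measurable_of_dependsOn (hf n)).stronglyMeasurable.aestronglyMeasurable
  have hs' : MeasurableSet s := (filtration m).le n s hs
  classical
  have hind : DependsOn (fun x => if x ∈ s then (1 : ℂ) else 0) (Set.Iio n) := fun x y hxy => by
    have : (x ∈ s) = (y ∈ s) := mem_iff_mem_of_measurableSet hs hxy
    simp only [this]
  have hd : DependsOn (fun x => f (n + 1) x - f n x) (Set.Iio (n + 1)) := fun x y hxy => by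
    simp only [hf (n + 1) hxy, dependsOn_mono (Nat.le_succ n) (hf n) hxy]
  have h := integral_mul_eq_zero hind hd (h0 n)
  rw [← sub_eq_zero, ← neg_eq_zero, neg_sub, ← integral_sub
    (integrable_of_dependsOn (hf (n + 1))).integrableOn
    (integrable_of_dependsOn (hf n)).integrableOn, ← integral_indicator hs', ← h]
  refine integral_congr_ae (Eventually.of_forall fun x => ?_)
  by_cases hx : x ∈ s <;> simp [hx]

end Basic

/-! ### Characters, Dirichlet and Fejér kernels -/

section Characters

variable {m : ℕ → ℕ} [∀ k, NeZero (m k)]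

theorem rademacher_eq_toCircle (k : ℕ) (x : VGroup m) :
    rademacher m k x = ZMod.toCircle (x k) := by
  rw [ZMod.toCircle_apply]; rfl

theorem norm_rademacher (k : ℕ) (x : VGroup m) : ‖rademacher m k x‖ = 1 := by
  rw [rademacher_eq_toCircle]
  exact Circle.norm_coe _

theorem rademacher_eq_one_of_eq_zero {k : ℕ} {x : VGroup m} (h : x k = 0) :
    rademacher m k x = 1 := by
  simp [rademacher_eq_toCircle, h]

theorem rademacher_sub (k : ℕ) (x y : VGroup m) :
    rademacher m k (x - y) = rademacher m k x * (starRingEnd ℂ) (rademacher m k y) := by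
  simp only [rademacher_eq_toCircle, Pi.sub_apply]
  rw [AddChar.map_sub_eq_div, Circle.coe_div, div_eq_mul_inv, ← Circle.coe_inv_eq_conj,
    Circle.coe_inv]

theorem rademacher_pow_self (k : ℕ) (x : VGroup m) : rademacher m k x ^ m k = 1 := by
  rw [rademacher_eq_toCircle, ← Circle.coe_pow, ← AddChar.map_nsmul_eq_pow]
  simp

theorem sum_rademacher_pow (k : ℕ) (x : VGroup m) :
    ∑ d ∈ Finset.range (m k), rademacher m k x ^ d = if x k = 0 then (m k : ℂ) else 0 := by
  split_ifs with h
  · simp [rademacher_eq_one_of_eq_zero h]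
  · have h1 : rademacher m k x ≠ 1 := by
      rw [rademacher_eq_toCircle]
      intro h1
      exact h (ZMod.injective_toCircle (by rw [Circle.coe_eq_one.1 h1, AddChar.map_zero_eq_one]))
    rw [geom_sum_eq h1, rademacher_pow_self]
    simp

/-- Shifting the summation variable by `1` multiplies the sum by the `c`-th power of a primitive `m
k`-th root of unity, which is not `1` for `0 < c < m k`. -/
theorem sum_rademacher_update_pow {k c : ℕ} (hc : c ≠ 0) (hck : c < m k) (x : VGroup m) :
    ∑ a : ZMod (m k), rademacher m k (Function.update x k a) ^ c = 0 := by
  simp only [rademacher_eq_toCircle, Function.update_self]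
  set S := ∑ a : ZMod (m k), (ZMod.toCircle a : ℂ) ^ c with hS
  have h1 : (ZMod.toCircle (1 : ZMod (m k)) : ℂ) ^ c * S = S := by
    rw [hS, Finset.mul_sum, ← Equiv.sum_comp (Equiv.addLeft (1 : ZMod (m k)))
      (fun a => (ZMod.toCircle a : ℂ) ^ c)]
    refine Finset.sum_congr rfl fun a _ => ?_
    simp [AddChar.map_add_eq_mul, mul_pow]
  have h2 : (ZMod.toCircle (1 : ZMod (m k)) : ℂ) ^ c ≠ 1 := by
    rw [← Circle.coe_pow, ← AddChar.map_nsmul_eq_pow]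
    intro h
    have := ZMod.injective_toCircle
      ((Circle.coe_eq_one.1 h).trans (AddChar.map_zero_eq_one (ZMod.toCircle (N := m k))).symm)
    simp only [nsmul_eq_mul, mul_one] at this
    rw [ZMod.natCast_eq_zero_iff] at this
    exact absurd (Nat.le_of_dvd (Nat.pos_of_ne_zero hc) this) (by omega)
  have h3 : ((ZMod.toCircle (1 : ZMod (m k)) : ℂ) ^ c - 1) * S = 0 := by
    rw [sub_mul, h1, one_mul, sub_self]
  exact (mul_eq_zero.1 h3).resolve_left (sub_ne_zero.2 h2)

theorem digit_eq_zero_of_lt {n k : ℕ} (h : n < M m k) : digit m n k = 0 := by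
  simp [digit, Nat.div_eq_of_lt h]

theorem psi_eq_prod (hm : ∀ k, 2 ≤ m k) {n N : ℕ} (h : n < M m N) (x : VGroup m) :
    psi m n x = ∏ k ∈ Finset.range N, rademacher m k x ^ digit m n k := by
  rw [psi, Finset.prod_subset (Finset.range_mono (le_max_left n N)),
    Finset.prod_subset (Finset.range_mono (le_max_right n N))]
  · intro k _ hk
    rw [digit_eq_zero_of_lt (h.trans_le (M_mono (by simpa using hk))), pow_zero]
  · intro k _ hk
    rw [digit_eq_zero m hm (by simpa using hk), pow_zero]

theorem M_succ_dvd {j N : ℕ} (h : j < N) : M m j * m j ∣ M m N := by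
  rw [← M_succ]
  exact Finset.prod_dvd_prod_of_subset _ _ _ (Finset.range_mono h)

theorem M_dvd {j N : ℕ} (h : j ≤ N) : M m j ∣ M m N :=
  Finset.prod_dvd_prod_of_subset _ _ _ (Finset.range_mono h)

/-- No carries occur: `c * M m N` has digits only from position `N` on, and `k` only below it. -/
theorem digit_mul_M_add {N k : ℕ} (hk : k < M m N) (c j : ℕ) :
    digit m (c * M m N + k) j = digit m (c * M m N) j + digit m k j := by
  rcases lt_or_ge j N with hj | hj
  · obtain ⟨R, hR⟩ := M_succ_dvd (m := m) hj
    have e : c * M m N = M m j * (m j * (c * R)) := by rw [hR]; ring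
    simp only [digit, e]
    rw [Nat.mul_add_div (M_pos j), Nat.mul_div_cancel_left _ (M_pos j), Nat.mul_add_mod,
      Nat.mul_mod_right, zero_add]
  · obtain ⟨R, hR⟩ := M_dvd (m := m) hj
    rw [digit_eq_zero_of_lt (hk.trans_le (M_mono hj)), add_zero]
    simp only [digit, hR, ← Nat.div_div_eq_div_mul]
    rw [Nat.mul_div_cancel _ (M_pos N), mul_comm c, Nat.mul_add_div (M_pos N),
      Nat.div_eq_of_lt hk, add_zero]

theorem psi_mul_M_add (hm : ∀ k, 2 ≤ m k) {N k : ℕ} (hk : k < M m N) (c : ℕ) (x : VGroup m) :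
    psi m (c * M m N + k) x = psi m (c * M m N) x * psi m k x := by
  have h := lt_M_self hm (c * M m N + k)
  rw [psi_eq_prod hm h, psi_eq_prod hm ((Nat.le_add_right _ _).trans_lt h),
    psi_eq_prod hm ((Nat.le_add_left _ _).trans_lt h), ← Finset.prod_mul_distrib]
  exact Finset.prod_congr rfl fun j _ => by rw [digit_mul_M_add hk, pow_add]

theorem psi_mul_M (hm : ∀ k, 2 ≤ m k) {N d : ℕ} (hd : d < m N) (x : VGroup m) :
    psi m (d * M m N) x = rademacher m N x ^ d := by
  have h : d * M m N < M m (N + 1) := by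
    rw [M_succ, mul_comm]
    exact Nat.mul_lt_mul_of_pos_left hd (M_pos N)
  rw [psi_eq_prod hm h, Finset.prod_range_succ, Finset.prod_eq_one]
  · simp [digit, Nat.mul_div_cancel _ (M_pos N), Nat.mod_eq_of_lt hd]
  · intro j hj
    obtain ⟨R, hR⟩ := M_succ_dvd (m := m) (Finset.mem_range.1 hj)
    have e : d * M m N = M m j * (m j * (d * R)) := by rw [hR]; ring
    rw [digit, e, Nat.mul_div_cancel_left _ (M_pos j), Nat.mul_mod_right, pow_zero]

theorem psi_zero (x : VGroup m) : psi m 0 x = 1 := by simp [psi]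

theorem norm_psi (n : ℕ) (x : VGroup m) : ‖psi m n x‖ = 1 := by
  simp [psi, norm_prod, norm_rademacher]

theorem psi_sub (n : ℕ) (x y : VGroup m) :
    psi m n (x - y) = psi m n x * (starRingEnd ℂ) (psi m n y) := by
  simp only [psi, map_prod, map_pow, rademacher_sub, mul_pow, Finset.prod_mul_distrib]

theorem dependsOn_psi (hm : ∀ k, 2 ≤ m k) {n N : ℕ} (h : n < M m N) :
    DependsOn (psi m n) (Set.Iio N) := fun x y hxy => by
  rw [psi_eq_prod hm h, psi_eq_prod hm h]
  refine Finset.prod_congr rfl fun k hk => ?_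
  rw [rademacher, rademacher, hxy k (Finset.mem_range.1 hk)]

/-- The Dirichlet kernel. -/
def dirichlet (m : ℕ → ℕ) (n : ℕ) (z : VGroup m) : ℂ := ∑ k ∈ Finset.range n, psi m k z

/-- The sum of the first `n` Dirichlet kernels, `n` times the Fejér kernel. -/
def fejerSum (m : ℕ → ℕ) (n : ℕ) (z : VGroup m) : ℂ :=
  ∑ k ∈ Finset.range n, dirichlet m k z

theorem dirichlet_mul_M_add (hm : ∀ k, 2 ≤ m k) {N k : ℕ} (hk : k ≤ M m N) (c : ℕ)
    (z : VGroup m) :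
    dirichlet m (c * M m N + k) z =
      dirichlet m (c * M m N) z + psi m (c * M m N) z * dirichlet m k z := by
  rw [dirichlet, Finset.sum_range_add, dirichlet, dirichlet, Finset.mul_sum]
  congr 1
  refine Finset.sum_congr rfl fun j hj => psi_mul_M_add hm ?_ c z
  exact (Finset.mem_range.1 hj).trans_le hk

theorem dirichlet_mul_M (hm : ∀ k, 2 ≤ m k) (N c : ℕ) (z : VGroup m) :
    dirichlet m (c * M m N) z =
      (∑ d ∈ Finset.range c, psi m (d * M m N) z) * dirichlet m (M m N) z := by
  induction c with
  | zero => simp [dirichlet]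
  | succ c ih =>
    rw [add_mul, one_mul, dirichlet_mul_M_add hm le_rfl, ih, Finset.sum_range_succ, add_mul]

theorem mem_interval_succ_zero_iff {N : ℕ} {z : VGroup m} :
    z ∈ interval m (N + 1) 0 ↔ z N = 0 ∧ z ∈ interval m N 0 := by
  constructor
  · intro h
    exact ⟨h N (by omega), fun k hk => h k (by omega)⟩
  · rintro ⟨h1, h2⟩ k hk
    rcases eq_or_ne k N with rfl | hne
    · exact h1
    · exact h2 k (by omega)

/-- Paley's formula: passing from `N` to `N + 1` multiplies the kernel by a full geometric sum of
`rademacher m N`, which is `m N` if `z N = 0` and vanishes otherwise. -/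
theorem dirichlet_M (hm : ∀ k, 2 ≤ m k) (N : ℕ) (z : VGroup m) :
    dirichlet m (M m N) z = (interval m N 0).indicator (fun _ => (M m N : ℂ)) z := by
  induction N with
  | zero =>
    have : z ∈ interval m 0 0 := fun k hk => absurd hk (by omega)
    simp [M_zero, this, dirichlet, psi_zero]
  | succ N ih =>
    rw [M_succ, mul_comm, dirichlet_mul_M hm, ih, Finset.sum_congr rfl
      (fun d hd => psi_mul_M hm (Finset.mem_range.1 hd) z), sum_rademacher_pow]
    by_cases h1 : z N = 0 <;> by_cases h2 : z ∈ interval m N 0 <;>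
      simp [mem_interval_succ_zero_iff, h1, h2]

theorem dirichlet_mul_M_eq_zero (hm : ∀ k, 2 ≤ m k) {N : ℕ} (c : ℕ) {z : VGroup m}
    (hz : z ∉ interval m N 0) : dirichlet m (c * M m N) z = 0 := by
  rw [dirichlet_mul_M hm, dirichlet_M hm, Set.indicator_of_notMem hz, mul_zero]

theorem norm_dirichlet_le (n : ℕ) (z : VGroup m) : ‖dirichlet m n z‖ ≤ n := by
  refine (norm_sum_le _ _).trans ?_
  simp [norm_psi]

theorem fejerSum_mul_M_add (hm : ∀ k, 2 ≤ m k) {N k : ℕ} (hk : k ≤ M m N) (c : ℕ)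
    (z : VGroup m) :
    fejerSum m (c * M m N + k) z = fejerSum m (c * M m N) z +
      k * dirichlet m (c * M m N) z + psi m (c * M m N) z * fejerSum m k z := by
  rw [fejerSum, Finset.sum_range_add, add_assoc]
  congr 1
  rw [Finset.sum_congr rfl fun j hj => dirichlet_mul_M_add hm
    ((Finset.mem_range.1 hj).le.trans hk) c z, Finset.sum_add_distrib, fejerSum, Finset.mul_sum]
  simp

theorem fejerSum_mul_M (hm : ∀ k, 2 ≤ m k) (N c : ℕ) (z : VGroup m) :
    fejerSum m (c * M m N) z = ∑ d ∈ Finset.range c,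
      (M m N * dirichlet m (d * M m N) z + psi m (d * M m N) z * fejerSum m (M m N) z) := by
  induction c with
  | zero => simp [fejerSum]
  | succ c ih =>
    rw [add_mul, one_mul, fejerSum_mul_M_add hm le_rfl, ih, Finset.sum_range_succ, add_assoc]

theorem dependsOn_dirichlet (hm : ∀ k, 2 ≤ m k) {n N : ℕ} (h : n ≤ M m N) :
    DependsOn (dirichlet m n) (Set.Iio N) := fun _ _ hxy =>
  Finset.sum_congr rfl fun _ hk =>
    dependsOn_psi hm ((Finset.mem_range.1 hk).trans_le h) hxy

theorem dependsOn_fejerSum (hm : ∀ k, 2 ≤ m k) {n N : ℕ} (h : n ≤ M m N) :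
    DependsOn (fejerSum m n) (Set.Iio N) := fun _ _ hxy =>
  Finset.sum_congr rfl fun _ hk =>
    dependsOn_dirichlet hm ((Finset.mem_range.1 hk).le.trans h) hxy

/-- Off `I_N(0)` every Dirichlet kernel of index a multiple of `M m N` vanishes, so only Fejér sums
of index at most `M m N`, times unimodular factors, remain. -/
theorem norm_fejerSum_mul_M_add_le_of_notMem (hm : ∀ k, 2 ≤ m k) {N k : ℕ} (hk : k ≤ M m N)
    (c : ℕ) {z : VGroup m} (hz : z ∉ interval m N 0) :
    ‖fejerSum m (c * M m N + k) z‖ ≤ c * ‖fejerSum m (M m N) z‖ + ‖fejerSum m k z‖ := by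
  rw [fejerSum_mul_M_add hm hk, fejerSum_mul_M hm, dirichlet_mul_M_eq_zero hm c hz, mul_zero,
    add_zero]
  refine (norm_add_le _ _).trans (add_le_add ?_ (by simp [norm_psi]))
  refine (norm_sum_le _ _).trans ?_
  simp [dirichlet_mul_M_eq_zero hm _ hz, norm_psi]

/-- The set of `z` whose coordinates before the `B`-th vanish, except possibly the `s`-th. -/
def slab (m : ℕ → ℕ) (s B : ℕ) : Set (VGroup m) := {z | ∀ j < B, j ≠ s → z j = 0}

theorem slab_eq_interval {s B : ℕ} (h : B ≤ s + 1) : slab m s B = interval m (min s B) 0 := by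
  ext z
  constructor
  · intro hz k hk
    exact hz k (by omega) (by omega)
  · intro hz k hk hks
    exact hz k (by omega)

/-- The majorant of the Fejér kernels of index less than `M_A`, up to a constant factor. -/
def majorant (m : ℕ → ℕ) (A : ℕ) (z : VGroup m) : ℝ :=
  ∑ B ∈ Finset.range A, ∑ s ∈ Finset.range (B + 1),
    (slab m s B).indicator (fun _ => (M m s * M m B : ℝ)) z

theorem majorant_nonneg (A : ℕ) (z : VGroup m) : 0 ≤ majorant m A z :=
  Finset.sum_nonneg fun _ _ => Finset.sum_nonneg fun _ _ =>
    Set.indicator_nonneg (fun _ _ => by positivity) _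

theorem norm_dirichlet_mul_M_le (hm : ∀ k, 2 ≤ m k) (N c : ℕ) (z : VGroup m) :
    ‖dirichlet m (c * M m N) z‖ ≤ (interval m N 0).indicator (fun _ => (c * M m N : ℝ)) z := by
  by_cases hz : z ∈ interval m N 0
  · rw [Set.indicator_of_mem hz]
    exact_mod_cast norm_dirichlet_le (c * M m N) z
  · rw [Set.indicator_of_notMem hz, dirichlet_mul_M_eq_zero hm c hz, norm_zero]

/-- In the recursion from `A` to `A + 1`, the old Fejér sum is multiplied by `m A` and survives only
if `z A = 0`, which turns the slabs of length `A` into those of length `A + 1`. The new Dirichlet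
terms live on `I_A(0)`, which is the slab for `s = A`. -/
theorem norm_fejerSum_M_le (hm : ∀ k, 2 ≤ m k) {b : ℕ} (hb : ∀ k, m k ≤ b) (A : ℕ)
    (z : VGroup m) :
    ‖fejerSum m (M m A) z‖ ≤
      b * ∑ s ∈ Finset.range A, (slab m s A).indicator (fun _ => (M m s * M m A : ℝ)) z := by
  induction A with
  | zero => simp [M_zero, fejerSum, dirichlet]
  | succ A ih =>
    have e : fejerSum m (M m (A + 1)) z = M m A * ∑ d ∈ Finset.range (m A),
        dirichlet m (d * M m A) z +
        (if z A = 0 then (m A : ℂ) else 0) * fejerSum m (M m A) z := by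
      rw [M_succ, mul_comm, fejerSum_mul_M hm, Finset.sum_add_distrib, ← Finset.mul_sum,
        ← Finset.sum_mul, Finset.sum_congr rfl
        (fun d hd => psi_mul_M hm (Finset.mem_range.1 hd) z), sum_rademacher_pow]
    rw [e, Finset.sum_range_succ, mul_add, add_comm]
    refine (norm_add_le _ _).trans (add_le_add ?_ ?_)
    · by_cases hz : z A = 0
      · rw [if_pos hz, norm_mul, Complex.norm_natCast]
        refine (mul_le_mul_of_nonneg_left ih (by positivity)).trans (le_of_eq ?_)
        rw [mul_left_comm, Finset.mul_sum]
        congr 1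
        refine Finset.sum_congr rfl fun s hs => ?_
        have hs' : z ∈ slab m s (A + 1) ↔ z ∈ slab m s A := by
          constructor
          · exact fun h j hj => h j (by omega)
          · intro h j hj hjs
            rcases eq_or_ne j A with rfl | hne
            · exact hz
            · exact h j (by omega) hjs
        by_cases hzs : z ∈ slab m s A
        · rw [Set.indicator_of_mem hzs, Set.indicator_of_mem (hs'.2 hzs), M_succ]
          push_cast; ring
        · rw [Set.indicator_of_notMem hzs, Set.indicator_of_notMem (fun h => hzs (hs'.1 h)),
            mul_zero]
      · rw [if_neg hz, zero_mul, norm_zero]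
        exact mul_nonneg (by positivity) (Finset.sum_nonneg fun s _ =>
          Set.indicator_nonneg (fun _ _ => by positivity) _)
    · rw [slab_eq_interval (by omega), min_eq_left (by omega), norm_mul, Complex.norm_natCast]
      have h1 : ‖∑ d ∈ Finset.range (m A), dirichlet m (d * M m A) z‖ ≤
          m A * (interval m A 0).indicator (fun _ => (m A * M m A : ℝ)) z := by
        refine (norm_sum_le _ _).trans ?_
        refine (Finset.sum_le_card_nsmul _ _ _ (fun d hd => ?_)).trans
          (le_of_eq (by rw [Finset.card_range, nsmul_eq_mul]))
        refine (norm_dirichlet_mul_M_le hm A d z).trans (Set.indicator_le_indicator ?_)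
        have : (d : ℝ) ≤ m A := by exact_mod_cast (Finset.mem_range.1 hd).le
        gcongr
      refine (mul_le_mul_of_nonneg_left h1 (by positivity)).trans ?_
      have h2 : (m A : ℝ) ≤ b := by exact_mod_cast hb A
      by_cases hz : z ∈ interval m A 0
      · rw [Set.indicator_of_mem hz, Set.indicator_of_mem hz, M_succ]
        push_cast
        have : (M m A : ℝ) * (m A * (m A * M m A)) = m A * (M m A * (M m A * m A)) := by ring
        rw [this]
        gcongr
      · rw [Set.indicator_of_notMem hz, Set.indicator_of_notMem hz]
        simp

/-- Splitting off the leading digit, `n = d * M m A + k`, costs Dirichlet terms on `I_A(0)` and `d`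
copies of the Fejér sum of index `M m A`. Together these are at most a constant times the `B = A`
layer of the majorant; the remainder `k` is covered by induction. -/
theorem norm_fejerSum_le (hm : ∀ k, 2 ≤ m k) {b : ℕ} (hb : ∀ k, m k ≤ b) {A n : ℕ}
    (hn : n < M m A) (z : VGroup m) :
    ‖fejerSum m n z‖ ≤ 2 * (b : ℝ) ^ 2 * majorant m A z := by
  induction A generalizing n with
  | zero =>
    rw [M_zero] at hn
    obtain rfl : n = 0 := by omega
    simp [fejerSum, majorant]
  | succ A ih =>
    set d := n / M m A with hd
    set k := n % M m A with hk
    have hkM : k < M m A := Nat.mod_lt _ (M_pos A)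
    have hnd : n = d * M m A + k := by rw [hd, hk, mul_comm]; exact (Nat.div_add_mod _ _).symm
    have hdb : d < m A := by
      rw [hd, Nat.div_lt_iff_lt_mul (M_pos A), mul_comm, ← M_succ]; exact hn
    have hdb' : (d : ℝ) + 1 ≤ b := by
      have := hb A
      exact_mod_cast (by omega : d + 1 ≤ b)
    have hkM' : (k : ℝ) ≤ M m A := by exact_mod_cast hkM.le
    set I := (interval m A 0).indicator (fun _ => (M m A * M m A : ℝ)) z with hI
    have hI0 : 0 ≤ I := Set.indicator_nonneg (fun _ _ => by positivity) _
    have hD : ∀ c : ℕ, M m A * ‖dirichlet m (c * M m A) z‖ ≤ c * I := by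
      intro c
      refine (mul_le_mul_of_nonneg_left (norm_dirichlet_mul_M_le hm A c z)
        (by positivity)).trans (le_of_eq ?_)
      by_cases hz : z ∈ interval m A 0
      · rw [hI, Set.indicator_of_mem hz, Set.indicator_of_mem hz]; ring
      · rw [hI, Set.indicator_of_notMem hz, Set.indicator_of_notMem hz]; simp
    have h1 : ‖fejerSum m (d * M m A) z‖ ≤ d * (d * I) + d * ‖fejerSum m (M m A) z‖ := by
      rw [fejerSum_mul_M hm]
      refine (norm_sum_le _ _).trans ((Finset.sum_le_card_nsmul _ _
        (d * I + ‖fejerSum m (M m A) z‖) (fun c hc => ?_)).trans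
        (le_of_eq (by rw [Finset.card_range, nsmul_eq_mul, mul_add])))
      refine (norm_add_le _ _).trans (add_le_add ?_ (by simp [norm_psi]))
      rw [norm_mul, Complex.norm_natCast]
      refine (hD c).trans ?_
      have : (c : ℝ) ≤ d := by exact_mod_cast (Finset.mem_range.1 hc).le
      gcongr
    have h2 : ‖(k : ℂ) * dirichlet m (d * M m A) z‖ ≤ d * I := by
      rw [norm_mul, Complex.norm_natCast]
      exact (mul_le_mul_of_nonneg_right hkM' (norm_nonneg _)).trans (hD d)
    have h3 : ‖fejerSum m n z‖ ≤ d * (d * I) + d * ‖fejerSum m (M m A) z‖ + d * I +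
        ‖fejerSum m k z‖ := by
      rw [hnd, fejerSum_mul_M_add hm hkM.le]
      refine (norm_add_le _ _).trans (add_le_add ((norm_add_le _ _).trans (add_le_add h1 h2)) ?_)
      simp [norm_psi]
    have h4 := ih hkM
    have h5 := norm_fejerSum_M_le hm hb A z
    set S := ∑ s ∈ Finset.range A, (slab m s A).indicator (fun _ => (M m s * M m A : ℝ)) z
    have hS0 : 0 ≤ S :=
      Finset.sum_nonneg fun _ _ => Set.indicator_nonneg (fun _ _ => by positivity) _
    have h6 : majorant m (A + 1) z = majorant m A z + (S + I) := by
      rw [majorant, Finset.sum_range_succ, ← majorant, Finset.sum_range_succ,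
        slab_eq_interval (s := A) (by omega), min_self]
    rw [h6]
    have hd0 : (0 : ℝ) ≤ d := by positivity
    have h7 : d * (d * I) + d * I ≤ (b : ℝ) ^ 2 * I := by
      rw [← mul_assoc, ← add_mul]
      gcongr
      nlinarith
    have h8 : d * ‖fejerSum m (M m A) z‖ ≤ (b : ℝ) ^ 2 * S := by
      calc d * ‖fejerSum m (M m A) z‖ ≤ b * (b * S) := by
            have hdb2 : (d : ℝ) ≤ b := by linarith
            gcongr
        _ = _ := by ring
    have h9 : 0 ≤ (b : ℝ) ^ 2 * I := by positivity
    have h10 : 0 ≤ (b : ℝ) ^ 2 * S := by positivity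
    linarith

end Characters

end Vilenkin

/-! ### Summation in weak-`L_{1/2}` -/

section WeakSum

variable {α : Type*} [MeasurableSpace α] {μ : Measure α}

/-- One term suffices: for the least `j` with `(r 2^{-(j+1)})² < v`, either `j = 0` and the term is
`r²`, or minimality gives `v ≤ (r 2^{-j})²`. -/
theorem min_sq_le_tsum_indicator (v : ℝ≥0∞) (r : ℝ≥0) :
    min v ((r : ℝ≥0∞) ^ 2) ≤ ∑' j : ℕ, if ((r * 2⁻¹ ^ (j + 1) : ℝ≥0) : ℝ≥0∞) ^ 2 < v
      then ((r * 2⁻¹ ^ j : ℝ≥0) : ℝ≥0∞) ^ 2 else 0 := by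
  classical
  rcases eq_or_ne v 0 with rfl | hv
  · simp
  have hex : ∃ j : ℕ, ((r * 2⁻¹ ^ (j + 1) : ℝ≥0) : ℝ≥0∞) ^ 2 < v := by
    have ht : Tendsto (fun j : ℕ => (r * 2⁻¹ ^ (j + 1) : ℝ≥0) ^ 2) atTop (nhds ((r * 0) ^ 2)) :=
      ((((NNReal.tendsto_pow_atTop_nhds_zero_of_lt_one (by norm_num)).comp
        (tendsto_add_atTop_nat 1)).const_mul r).pow 2)
    have ht' := ENNReal.tendsto_coe.2 ht
    simp only [mul_zero, ne_eq, OfNat.ofNat_ne_zero, not_false_eq_true, zero_pow,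
      ENNReal.coe_zero] at ht'
    obtain ⟨j, hj⟩ := (ht'.eventually (gt_mem_nhds (pos_iff_ne_zero.2 hv))).exists
    exact ⟨j, by simpa using hj⟩
  refine le_trans ?_ (ENNReal.le_tsum (Nat.find hex))
  rw [if_pos (Nat.find_spec hex)]
  rcases Nat.eq_zero_or_eq_succ_pred (Nat.find hex) with h | h
  · rw [h]; simp
  · have := Nat.find_min hex (m := (Nat.find hex).pred) (by omega)
    rw [← Nat.succ_eq_add_one, ← h] at this
    exact (min_le_left _ _).trans (not_lt.1 this)

/-- Layers of square size turn the hypothesis into a convergent geometric series: the layer at `ρ =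
r 2^{-(j+1)}` contributes at most `4 ρ² μ(g > ρ²) ≤ 4 ρ A`. -/
theorem lintegral_min_sq_le {g : α → ℝ≥0∞} (hg : Measurable g) {A : ℝ≥0∞}
    (h : ∀ r : ℝ≥0, 0 < r → r * μ {x | (r : ℝ≥0∞) ^ 2 < g x} ≤ A) {r : ℝ≥0} (hr : 0 < r) :
    ∫⁻ x, min (g x) ((r : ℝ≥0∞) ^ 2) ∂μ ≤ 4 * r * A := by
  have hmeas : ∀ j : ℕ,
      MeasurableSet {x | ((r * 2⁻¹ ^ (j + 1) : ℝ≥0) : ℝ≥0∞) ^ 2 < g x} := fun j =>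
    measurableSet_lt measurable_const hg
  calc ∫⁻ x, min (g x) ((r : ℝ≥0∞) ^ 2) ∂μ
      ≤ ∫⁻ x, ∑' j : ℕ, {x | ((r * 2⁻¹ ^ (j + 1) : ℝ≥0) : ℝ≥0∞) ^ 2 < g x}.indicator
          (fun _ => ((r * 2⁻¹ ^ j : ℝ≥0) : ℝ≥0∞) ^ 2) x ∂μ := by
        refine lintegral_mono fun x => (min_sq_le_tsum_indicator (g x) r).trans (le_of_eq ?_)
        refine tsum_congr fun j => ?_
        simp [Set.indicator_apply]
    _ = ∑' j : ℕ, ((r * 2⁻¹ ^ j : ℝ≥0) : ℝ≥0∞) ^ 2 *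
          μ {x | ((r * 2⁻¹ ^ (j + 1) : ℝ≥0) : ℝ≥0∞) ^ 2 < g x} := by
        rw [lintegral_tsum fun j => (measurable_const.indicator (hmeas j)).aemeasurable]
        exact tsum_congr fun j => lintegral_indicator_const (hmeas j) _
    _ ≤ ∑' j : ℕ, 4 * r * A * 2⁻¹ ^ (j + 1) := by
        refine ENNReal.tsum_le_tsum fun j => ?_
        have e : ((r * 2⁻¹ ^ j : ℝ≥0) : ℝ≥0∞) ^ 2 =
            ((4 * r * 2⁻¹ ^ (j + 1) : ℝ≥0) : ℝ≥0∞) * ((r * 2⁻¹ ^ (j + 1) : ℝ≥0) : ℝ≥0∞) := by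
          rw [← ENNReal.coe_pow, ← ENNReal.coe_mul]
          congr 1
          rw [pow_succ (2⁻¹ : ℝ≥0) j]
          have : (4 : ℝ≥0) * 2⁻¹ * 2⁻¹ = 1 := by norm_num
          calc (r * 2⁻¹ ^ j) ^ 2 = (4 * 2⁻¹ * 2⁻¹) * (r * 2⁻¹ ^ j) ^ 2 := by rw [this, one_mul]
            _ = _ := by ring
        rw [e, mul_assoc]
        refine (mul_le_mul_right (h _ (by positivity)) _).trans (le_of_eq ?_)
        push_cast
        ring
    _ = 4 * r * A := by
        rw [ENNReal.tsum_mul_left, ENNReal.tsum_geometric_add_one, ENNReal.one_sub_inv_two, inv_inv,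
          ENNReal.inv_mul_cancel (by norm_num) (by norm_num), mul_one]

/-- Weak-`L_{1/2}` functions may be summed: the quasi-norms, to the power `1/2`, add up
to a constant factor. -/
theorem weak_half_sum_le {ι : Type*} (S : Finset ι) {g : ι → α → ℝ≥0∞} {A : ι → ℝ≥0∞}
    (hg : ∀ i ∈ S, Measurable (g i))
    (h : ∀ i ∈ S, ∀ r : ℝ≥0, 0 < r → r * μ {x | (r : ℝ≥0∞) ^ 2 < g i x} ≤ A i)
    {r : ℝ≥0} (hr : 0 < r) :
    r * μ {x | (r : ℝ≥0∞) ^ 2 < ∑ i ∈ S, g i x} ≤ 5 * ∑ i ∈ S, A i := by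
  have hr0 : (r : ℝ≥0∞) ≠ 0 := by exact_mod_cast hr.ne'
  -- Either a single summand exceeds `r²`, handled by the union bound, or truncation at `r²` changes
  -- nothing, and Markov's inequality applies to the truncated sum.
  have hsub : {x | (r : ℝ≥0∞) ^ 2 < ∑ i ∈ S, g i x} ⊆
      (⋃ i ∈ S, {x | (r : ℝ≥0∞) ^ 2 < g i x}) ∪
        {x | (r : ℝ≥0∞) ^ 2 ≤ ∑ i ∈ S, min (g i x) ((r : ℝ≥0∞) ^ 2)} := by
    intro x hx
    by_cases hx' : ∃ i ∈ S, (r : ℝ≥0∞) ^ 2 < g i x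
    · left; simpa using hx'
    · right
      push Not at hx'
      have : ∑ i ∈ S, min (g i x) ((r : ℝ≥0∞) ^ 2) = ∑ i ∈ S, g i x :=
        Finset.sum_congr rfl fun i hi => min_eq_left (hx' i hi)
      simp only [Set.mem_ofPred_eq] at hx ⊢
      rw [this]
      exact hx.le
  have h1 : r * μ (⋃ i ∈ S, {x | (r : ℝ≥0∞) ^ 2 < g i x}) ≤ ∑ i ∈ S, A i := by
    refine (mul_le_mul_right (measure_biUnion_finset_le _ _) _).trans ?_
    rw [Finset.mul_sum]
    exact Finset.sum_le_sum fun i hi => h i hi r hr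
  have h2 : r * μ {x | (r : ℝ≥0∞) ^ 2 ≤ ∑ i ∈ S, min (g i x) ((r : ℝ≥0∞) ^ 2)} ≤
      4 * ∑ i ∈ S, A i := by
    have h3 : (r : ℝ≥0∞) ^ 2 * μ {x | (r : ℝ≥0∞) ^ 2 ≤ ∑ i ∈ S, min (g i x) ((r : ℝ≥0∞) ^ 2)} ≤
        r * (4 * ∑ i ∈ S, A i) := by
      have hmm : ∀ i ∈ S, Measurable fun x => min (g i x) ((r : ℝ≥0∞) ^ 2) := fun i hi =>
        (hg i hi).min measurable_const
      refine (mul_meas_ge_le_lintegral (Finset.measurable_fun_sum S hmm) _).trans ?_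
      rw [lintegral_finsetSum S hmm, Finset.mul_sum, Finset.mul_sum]
      refine Finset.sum_le_sum fun i hi => ?_
      refine (lintegral_min_sq_le (hg i hi) (h i hi) hr).trans (le_of_eq (by ring))
    refine (ENNReal.mul_le_mul_iff_right hr0 (by simp)).1 ?_
    rwa [← mul_assoc, ← sq]
  calc r * μ {x | (r : ℝ≥0∞) ^ 2 < ∑ i ∈ S, g i x}
      ≤ r * (μ (⋃ i ∈ S, {x | (r : ℝ≥0∞) ^ 2 < g i x}) +
        μ {x | (r : ℝ≥0∞) ^ 2 ≤ ∑ i ∈ S, min (g i x) ((r : ℝ≥0∞) ^ 2)}) :=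
        mul_le_mul_right ((measure_mono hsub).trans (measure_union_le _ _)) _
    _ ≤ ∑ i ∈ S, A i + 4 * ∑ i ∈ S, A i := by
        rw [mul_add]
        exact add_le_add h1 h2
    _ = 5 * ∑ i ∈ S, A i := by ring

end WeakSum

namespace Vilenkin

/-! ### Strong and weak estimates of the kernel majorant -/

section KernelBounds

variable {m : ℕ → ℕ} [∀ k, NeZero (m k)]

theorem sub_mem_slab_iff {s B : ℕ} {x y : VGroup m} :
    x - y ∈ slab m s B ↔ ∀ j < B, j ≠ s → x j = y j := by
  simp [slab, sub_eq_zero]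

theorem sub_mem_interval_iff {n : ℕ} {x y : VGroup m} :
    x - y ∈ interval m n 0 ↔ x ∈ interval m n y := by
  simp [interval, sub_eq_zero]

theorem measurableSet_sub_mem_slab (s B : ℕ) (x : VGroup m) :
    MeasurableSet {y | x - y ∈ slab m s B} := by
  refine measurableSet_setOfPred.2 (measurable_of_dependsOn' (n := B) fun y z hyz => ?_)
  simp only [sub_mem_slab_iff, eq_iff_iff]
  exact forall₂_congr fun j hj => by rw [hyz j hj]

theorem haar_sub_mem_slab_le {b : ℕ} (hb : ∀ k, m k ≤ b) (s B : ℕ) (x : VGroup m) :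
    haar m {y | x - y ∈ slab m s B} ≤ ENNReal.ofReal (b / M m B) := by
  have hsub : {y | x - y ∈ slab m s B} ⊆
      ⋃ a : ZMod (m s), interval m B (Function.update x s a) := by
    intro y hy
    rw [Set.mem_ofPred_eq, sub_mem_slab_iff] at hy
    refine Set.mem_iUnion.2 ⟨y s, fun j hj => ?_⟩
    rcases eq_or_ne j s with rfl | hne
    · simp
    · rw [Function.update_of_ne hne, hy j hj hne]
  refine (measure_mono hsub).trans ((measure_iUnion_le _).trans ?_)
  rw [tsum_fintype]
  simp only [haar_interval, Finset.sum_const, Finset.card_univ, ZMod.card, nsmul_eq_mul]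
  have hM : (0 : ℝ) < M m B := by exact_mod_cast M_pos B
  rw [ENNReal.ofReal_div_of_pos hM, ENNReal.ofReal_natCast, ENNReal.ofReal_natCast, div_eq_mul_inv]
  have : (m s : ℝ≥0∞) ≤ b := by exact_mod_cast hb s
  gcongr

theorem haar_mem_slab_sub_le {b : ℕ} (hb : ∀ k, m k ≤ b) (s B : ℕ) (u : VGroup m) :
    haar m {x | x - u ∈ slab m s B} ≤ ENNReal.ofReal (b / M m B) := by
  refine le_trans (le_of_eq ?_) (haar_sub_mem_slab_le hb s B u)
  congr 1
  ext x
  simp only [Set.mem_ofPred_eq, sub_mem_slab_iff, eq_comm]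

theorem integrable_slab_indicator (s B : ℕ) (c : ℝ) (x : VGroup m) :
    Integrable (fun y => (slab m s B).indicator (fun _ => c) (x - y)) (haar m) :=
  (integrable_const c).indicator (measurableSet_sub_mem_slab s B x)

theorem integrable_majorant_sub (A : ℕ) (x : VGroup m) :
    Integrable (fun y => majorant m A (x - y)) (haar m) :=
  integrable_finsetSum _ fun B _ => integrable_finsetSum _ fun s _ =>
    integrable_slab_indicator s B _ x

/-- A slab of height `M_s M_B` has measure at most `b / M_B`, hence contributes at most `b M_s`; the
sums over `s` and then over `B` are geometric. -/
theorem integral_majorant_sub_le (hm : ∀ k, 2 ≤ m k) {b : ℕ} (hb : ∀ k, m k ≤ b) (A : ℕ)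
    (x : VGroup m) : ∫ y, majorant m (A + 1) (x - y) ∂haar m ≤ 4 * b * M m A := by
  simp only [majorant]
  rw [integral_finsetSum _ fun B _ => integrable_finsetSum _ fun s _ =>
    integrable_slab_indicator s B _ x]
  calc _ ≤ ∑ B ∈ Finset.range (A + 1), (2 * b * M m B : ℝ) := by
        refine Finset.sum_le_sum fun B _ => ?_
        rw [integral_finsetSum _ fun s _ => integrable_slab_indicator s B _ x]
        have hM : (0 : ℝ) < M m B := by exact_mod_cast M_pos B
        calc _ ≤ ∑ s ∈ Finset.range (B + 1), (b * M m s : ℝ) := by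
              refine Finset.sum_le_sum fun s _ => ?_
              have e : (fun y => (slab m s B).indicator (fun _ => (M m s * M m B : ℝ)) (x - y)) =
                  {y | x - y ∈ slab m s B}.indicator fun _ => (M m s * M m B : ℝ) := rfl
              rw [e, integral_indicator_const _ (measurableSet_sub_mem_slab s B x), smul_eq_mul]
              have h1 : (haar m).real {y | x - y ∈ slab m s B} ≤ b / M m B :=
                ENNReal.toReal_le_of_le_ofReal (by positivity) (haar_sub_mem_slab_le hb s B x)
              refine (mul_le_mul_of_nonneg_right h1 (by positivity)).trans (le_of_eq ?_)
              field_simp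
          _ ≤ _ := by
              rw [← Finset.mul_sum]
              have := mul_le_mul_of_nonneg_left (sum_M_le hm B) (Nat.cast_nonneg (α := ℝ) b)
              linarith
    _ ≤ _ := by
        rw [← Finset.mul_sum]
        have := mul_le_mul_of_nonneg_left (sum_M_le hm A)
          (by positivity : (0 : ℝ) ≤ 2 * b)
        linarith

/-- The Fejér means are uniformly bounded on bounded functions. -/
theorem norm_integral_mul_fejerSum_le (hm : ∀ k, 2 ≤ m k) {b : ℕ} (hb : ∀ k, m k ≤ b)
    {F : VGroup m → ℂ} {H : ℝ} (hF : ∀ y, ‖F y‖ ≤ H) (n : ℕ) (x : VGroup m) :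
    ‖∫ y, F y * fejerSum m n (x - y) ∂haar m‖ ≤ 8 * (b : ℝ) ^ 3 * H * n := by
  have hH : 0 ≤ H := (norm_nonneg _).trans (hF x)
  rcases Nat.eq_zero_or_pos n with rfl | hn
  · simp [fejerSum]
  obtain ⟨A, hA1, hA2⟩ := exists_M_le_lt hm hn
  have h1 : ‖∫ y, F y * fejerSum m n (x - y) ∂haar m‖ ≤
      ∫ y, H * (2 * (b : ℝ) ^ 2) * majorant m (A + 1) (x - y) ∂haar m := by
    refine norm_integral_le_of_norm_le ((integrable_majorant_sub _ x).const_mul _)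
      (Eventually.of_forall fun y => ?_)
    rw [norm_mul, mul_assoc]
    exact mul_le_mul (hF y) (norm_fejerSum_le hm hb hA2 _) (norm_nonneg _) hH
  rw [integral_const_mul] at h1
  have h2 : (M m A : ℝ) ≤ n := by exact_mod_cast hA1
  calc _ ≤ _ := h1
    _ ≤ H * (2 * (b : ℝ) ^ 2) * (4 * b * M m A) := by
        gcongr
        exact integral_majorant_sub_le hm hb A x
    _ ≤ H * (2 * (b : ℝ) ^ 2) * (4 * b * n) := by gcongr
    _ = _ := by ring

/-- Up to a constant the double sum defining the majorant is its largest term: `s` is the first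
nonzero coordinate of `z`, and `B` is the length up to which `z` vanishes apart from it. -/
theorem exists_majorant_le (hm : ∀ k, 2 ≤ m k) {N : ℕ} {z : VGroup m}
    (hz : z ∉ interval m N 0) :
    ∃ s B, s < B ∧ B ≤ N ∧ z ∈ slab m s B ∧ majorant m (N + 1) z ≤ 4 * (M m s * M m B) := by
  classical
  have hex : ∃ k, k < N ∧ z k ≠ 0 := by
    by_contra hcon
    push Not at hcon
    exact hz fun k hk => hcon k hk
  set s := Nat.find hex with hs
  obtain ⟨hsN, hzs⟩ : s < N ∧ z s ≠ 0 := Nat.find_spec hex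
  have hlt : ∀ k < s, z k = 0 := fun k hk => by
    have := Nat.find_min hex hk
    push Not at this
    exact this (hk.trans hsN)
  have hs1 : z ∈ slab m s (s + 1) := fun j hj hjs => hlt j (by omega)
  set B := Nat.findGreatest (fun B => z ∈ slab m s B) N with hB
  have hsB : s + 1 ≤ B := Nat.le_findGreatest (by omega) hs1
  have hBN : B ≤ N := Nat.findGreatest_le N
  have hzB : z ∈ slab m s B := Nat.findGreatest_spec (P := fun B => z ∈ slab m s B) hsN hs1
  refine ⟨s, B, hsB, hBN, hzB, ?_⟩
  have hle : ∀ t C, (slab m t C).indicator (fun _ => (M m t * M m C : ℝ)) z ≤ M m t * M m C :=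
    fun t C => Set.indicator_le_self' (f := fun _ => (M m t * M m C : ℝ))
      (fun _ _ => by positivity) z
  have hinner : ∀ C ∈ Finset.range (N + 1), ∑ t ∈ Finset.range (C + 1),
      (slab m t C).indicator (fun _ => (M m t * M m C : ℝ)) z ≤
        if C ∈ Finset.range (B + 1) then (2 * M m s * M m C : ℝ) else 0 := by
    intro C hC
    have hCN : C ≤ N := Nat.lt_succ_iff.1 (Finset.mem_range.1 hC)
    -- Layers with `C ≤ s` are bounded by summing all `t ≤ C`. For `C > s`, only the slab exempting
    -- `s` can contain `z`, since `z s ≠ 0`, and it does so only if `C ≤ B`.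
    rcases le_or_gt C s with hCs | hCs
    · rw [if_pos (Finset.mem_range.2 (by omega))]
      calc _ ≤ ∑ t ∈ Finset.range (C + 1), (M m t * M m C : ℝ) :=
            Finset.sum_le_sum fun t _ => hle t C
        _ ≤ 2 * M m C * M m C := by
            rw [← Finset.sum_mul]
            gcongr
            exact sum_M_le hm C
        _ ≤ _ := by
            have : (M m C : ℝ) ≤ M m s := by exact_mod_cast M_mono hCs
            gcongr
    · have hne : ∀ t, t ≠ s → z ∉ slab m t C := fun t hts h => hzs (h s hCs hts.symm)
      rw [Finset.sum_eq_single s (fun t _ hts => Set.indicator_of_notMem (hne t hts) _)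
        (fun h => absurd (Finset.mem_range.2 (by omega)) h)]
      split_ifs with hCB
      · refine (hle s C).trans ?_
        have : (0 : ℝ) ≤ M m s * M m C := by positivity
        linarith
      · rw [Set.indicator_of_notMem]
        intro h
        exact hCB (Finset.mem_range.2 (Nat.lt_succ_iff.2
          (Nat.le_findGreatest (P := fun B => z ∈ slab m s B) hCN h)))
  refine (Finset.sum_le_sum hinner).trans ?_
  rw [Finset.sum_ite_mem, Finset.inter_eq_right.2 (Finset.range_mono (by omega)),
    ← Finset.mul_sum]
  have := mul_le_mul_of_nonneg_left (sum_M_le hm B) (by positivity : (0 : ℝ) ≤ 2 * M m s)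
  linarith

theorem sum_M_filter_le (hm : ∀ k, 2 ≤ m k) {r : ℝ} (hr : 0 < r) (N : ℕ) :
    ∑ s ∈ Finset.range N, (if (M m s : ℝ) ≤ r then (M m s : ℝ) else 0) ≤ 2 * r := by
  induction N with
  | zero => simp; positivity
  | succ N ih =>
    by_cases h : (M m N : ℝ) ≤ r
    · calc _ ≤ ∑ s ∈ Finset.range (N + 1), (M m s : ℝ) := by
            refine Finset.sum_le_sum fun s _ => ?_
            split_ifs
            · exact le_rfl
            · positivity
        _ ≤ 2 * M m N := sum_M_le hm N
        _ ≤ 2 * r := by gcongr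
    · rw [Finset.sum_range_succ, if_neg h, add_zero]
      exact ih

theorem sum_inv_M_filter_le (hm : ∀ k, 2 ≤ m k) {r : ℝ} (hr : 0 < r) (N : ℕ) :
    ∑ s ∈ Finset.range N, (if (M m s : ℝ) ≤ r then 0 else (M m s : ℝ)⁻¹) ≤ 2 * r⁻¹ := by
  suffices h : ∑ s ∈ Finset.range N, (if (M m s : ℝ) ≤ r then 0 else (M m s : ℝ)⁻¹) +
      (if (M m N : ℝ) ≤ r then 0 else 2 * (M m N : ℝ)⁻¹) ≤ 2 * r⁻¹ by
    refine le_trans (le_add_of_nonneg_right ?_) h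
    split_ifs
    · exact le_rfl
    · positivity
  induction N with
  | zero =>
    simp only [Finset.range_zero, Finset.sum_empty, zero_add]
    split_ifs with h
    · positivity
    · have := inv_anti₀ hr (not_le.1 h).le
      linarith
  | succ N ih =>
    have hM : (0 : ℝ) < M m N := by exact_mod_cast M_pos N
    have h2 : (2 * M m N : ℝ) ≤ M m (N + 1) := by exact_mod_cast two_mul_M_le hm N
    by_cases h : (M m N : ℝ) ≤ r
    · rw [Finset.sum_eq_zero]
      · rw [zero_add]
        split_ifs with h'
        · positivity
        · have := inv_anti₀ hr (not_le.1 h').le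
          linarith
      · intro s hs
        have : (M m s : ℝ) ≤ M m N := by
          exact_mod_cast M_mono (Nat.lt_succ_iff.1 (Finset.mem_range.1 hs))
        rw [if_pos (this.trans h)]
    · rw [if_neg h] at ih
      rw [Finset.sum_range_succ, if_neg h, if_neg (by linarith)]
      have h3 : 2 * (M m (N + 1) : ℝ)⁻¹ ≤ (M m N : ℝ)⁻¹ := by
        have := inv_anti₀ (by positivity) h2
        rw [mul_inv] at this
        linarith
      linarith

/-- The weak-`L_{1/2}` bound of the majorant of the Fejér kernels. -/
theorem haar_exists_slab_le (hm : ∀ k, 2 ≤ m k) {b : ℕ} (hb : ∀ k, m k ≤ b) (N : ℕ)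
    (u : VGroup m) {r : ℝ} (hr : 0 < r) :
    haar m {x | ∃ s B, s < B ∧ B ≤ N ∧ x - u ∈ slab m s B ∧ r ^ 2 < M m s * M m B} ≤
      ENNReal.ofReal (4 * b / r) := by
  classical
  set E : ℕ → Set (VGroup m) := fun s =>
    {x | ∃ B, s < B ∧ x - u ∈ slab m s B ∧ r ^ 2 < M m s * M m B} with hE
  have hsub : {x | ∃ s B, s < B ∧ B ≤ N ∧ x - u ∈ slab m s B ∧ r ^ 2 < M m s * M m B} ⊆
      ⋃ s ∈ Finset.range N, E s := by
    rintro x ⟨s, B, hsB, hBN, hx, hr⟩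
    exact Set.mem_biUnion (Finset.mem_coe.2 (Finset.mem_range.2 (by omega))) ⟨B, hsB, hx, hr⟩
  have hEs : ∀ s, haar m (E s) ≤ ENNReal.ofReal
      (b * (r ^ 2)⁻¹ * (if (M m s : ℝ) ≤ r then (M m s : ℝ) else 0) +
        b * (if (M m s : ℝ) ≤ r then 0 else (M m s : ℝ)⁻¹)) := by
    intro s
    -- Slabs with fixed `s` shrink as `B` grows, so only the least admissible `B` matters. Its
    -- measure bound `b / M_B` is below both `b M_s / r²` and `b / M_s`; using the first for `M_s ≤
    -- r` and the second beyond makes the sum over `s` geometric on both sides of `r`.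
    by_cases hex : ∃ B, s < B ∧ r ^ 2 < M m s * M m B
    · have hss : E s ⊆ {x | x - u ∈ slab m s (Nat.find hex)} := by
        rintro x ⟨B, hsB, hx, hB⟩ j hj hjs
        exact hx j (hj.trans_le (Nat.find_min' hex ⟨hsB, hB⟩)) hjs
      refine (measure_mono hss).trans ((haar_mem_slab_sub_le hb s _ u).trans ?_)
      obtain ⟨h1, h2⟩ := Nat.find_spec hex
      set B := Nat.find hex
      have hMs : (0 : ℝ) < M m s := by exact_mod_cast M_pos s
      have hMB : (0 : ℝ) < M m B := by exact_mod_cast M_pos B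
      refine ENNReal.ofReal_le_ofReal ?_
      split_ifs with h
      · rw [mul_zero, add_zero, mul_assoc, div_eq_mul_inv]
        refine mul_le_mul_of_nonneg_left ?_ (by positivity)
        rw [inv_mul_eq_div, le_div_iff₀ (by positivity), inv_mul_eq_div, div_le_iff₀ hMB]
        exact h2.le
      · rw [mul_zero, zero_add, div_eq_mul_inv]
        refine mul_le_mul_of_nonneg_left (inv_anti₀ hMs ?_) (by positivity)
        exact_mod_cast M_mono h1.le
    · have : E s = ∅ := by
        ext x
        simp only [hE, Set.mem_ofPred_eq, Set.mem_empty_iff_false, iff_false]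
        rintro ⟨B, h1, _, h2⟩
        exact hex ⟨B, h1, h2⟩
      rw [this, measure_empty]
      exact zero_le
  refine (measure_mono hsub).trans ((measure_biUnion_finset_le _ _).trans
    ((Finset.sum_le_sum fun s _ => hEs s).trans ?_))
  rw [← ENNReal.ofReal_sum_of_nonneg]
  · refine ENNReal.ofReal_le_ofReal ?_
    rw [Finset.sum_add_distrib, ← Finset.mul_sum, ← Finset.mul_sum]
    calc _ ≤ b * (r ^ 2)⁻¹ * (2 * r) + b * (2 * r⁻¹) := by
          gcongr
          · exact sum_M_filter_le hm hr N
          · exact sum_inv_M_filter_le hm hr N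
      _ = 4 * b / r := by field_simp; ring
  · intro s _
    split_ifs <;> positivity

end KernelBounds

/-! ### Fejér means of atoms and of martingales -/

section Atoms

variable {m : ℕ → ℕ} [∀ k, NeZero (m k)]

theorem dependsOn_mem_interval (n : ℕ) (u : VGroup m) :
    DependsOn (· ∈ interval m n u) (Set.Iio n) := fun x y hxy => by
  simp only [interval, Set.mem_ofPred_eq, eq_iff_iff]
  exact forall₂_congr fun k hk => by rw [hxy k hk]

theorem dependsOn_majorant (N : ℕ) : DependsOn (majorant m (N + 1)) (Set.Iio N) :=
    fun x y hxy => by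
  classical
  refine Finset.sum_congr rfl fun B hB => Finset.sum_congr rfl fun s _ => ?_
  have : x ∈ slab m s B ↔ y ∈ slab m s B := forall₂_congr fun k hk => by
    rw [hxy k (hk.trans_le (Nat.lt_succ_iff.1 (Finset.mem_range.1 hB)))]
  simp only [Set.indicator_apply, this]

theorem dependsOn_comp_sub {β : Type*} {n : ℕ} {g : VGroup m → β} (hg : DependsOn g (Set.Iio n))
    (x : VGroup m) : DependsOn (fun y => g (x - y)) (Set.Iio n) := fun y z hyz =>
  hg fun k hk => by simp [hyz k hk]

theorem dependsOn_comp_sub_right {β : Type*} {n : ℕ} {g : VGroup m → β}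
    (hg : DependsOn g (Set.Iio n)) (u : VGroup m) :
    DependsOn (fun y => g (y - u)) (Set.Iio n) := fun y z hyz =>
  hg fun k hk => by simp [hyz k hk]

open Classical in
/-- A pointwise bound of all Fejér means of a function bounded by `H`, supported on `I_N(u)` and
orthogonal to the first `M_N` characters. -/
def envelope (m : ℕ → ℕ) (b N : ℕ) (u : VGroup m) (H : ℝ) (x : VGroup m) : ℝ :=
  if x ∈ interval m N u then 8 * (b : ℝ) ^ 3 * H
  else 4 * (b : ℝ) ^ 2 * H / (M m N : ℝ) ^ 2 * majorant m (N + 1) (x - u)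

theorem dependsOn_envelope (b N : ℕ) (u : VGroup m) (H : ℝ) :
    DependsOn (envelope m b N u H) (Set.Iio N) := fun x y hxy => by
  have h1 : (x ∈ interval m N u) = (y ∈ interval m N u) := dependsOn_mem_interval N u hxy
  have h2 : majorant m (N + 1) (x - u) = majorant m (N + 1) (y - u) :=
    dependsOn_comp_sub_right (dependsOn_majorant N) u hxy
  by_cases hy : y ∈ interval m N u
  · rw [envelope, envelope, if_pos hy, if_pos (h1.mpr hy)]
  · rw [envelope, envelope, if_neg hy, if_neg fun h => hy (h1.mp h), h2]

/-- Inside `I_N(u)`, boundedness of the Fejér means suffices. Outside, the means with `n ≤ M_N`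
vanish. For larger `n` the leading part `c * M m N` reduces the kernel to Fejér sums of index at
most `M_N`, which depend on `N` coordinates only, so `x - y` may be replaced by `x - u`; integration
over `I_N(u)` supplies the factor `1 / M_N`. -/
theorem norm_integral_mul_fejerSum_le_envelope (hm : ∀ k, 2 ≤ m k) {b : ℕ} (hb : ∀ k, m k ≤ b)
    {N : ℕ} {u : VGroup m} {F : VGroup m → ℂ} {H : ℝ} (hF : ∀ y, ‖F y‖ ≤ H)
    (hsupp : ∀ y, y ∉ interval m N u → F y = 0)
    (hvan : ∀ n ≤ M m N, ∀ x, ∫ y, F y * fejerSum m n (x - y) ∂haar m = 0) (n : ℕ)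
    (x : VGroup m) :
    ‖∫ y, F y * fejerSum m n (x - y) ∂haar m‖ ≤ n * envelope m b N u H x := by
  have hH : 0 ≤ H := (norm_nonneg _).trans (hF x)
  by_cases hx : x ∈ interval m N u
  · rw [envelope, if_pos hx, mul_comm]
    exact norm_integral_mul_fejerSum_le hm hb hF n x
  rw [envelope, if_neg hx]
  have hmaj := majorant_nonneg (N + 1) (x - u)
  rcases le_or_gt n (M m N) with hn | hn
  · rw [hvan n hn, norm_zero]
    positivity
  set c := n / M m N with hc
  set k := n % M m N with hk
  have hkM : k < M m N := Nat.mod_lt _ (M_pos N)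
  have hnc : n = c * M m N + k := by rw [hc, hk, mul_comm]; exact (Nat.div_add_mod _ _).symm
  have hc1 : 1 ≤ c := by rw [hc, Nat.one_le_div_iff (M_pos N)]; exact hn.le
  set K := 2 * (b : ℝ) ^ 2 * majorant m (N + 1) (x - u) with hK
  have hK0 : 0 ≤ K := by positivity
  have hpt : ∀ y, ‖F y * fejerSum m n (x - y)‖ ≤
      (interval m N u).indicator (fun _ => H * ((c + 1) * K)) y := by
    intro y
    by_cases hy : y ∈ interval m N u
    · rw [Set.indicator_of_mem hy, norm_mul]
      refine mul_le_mul (hF y) ?_ (norm_nonneg _) hH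
      have hxy : x - y ∉ interval m N 0 := by
        rw [sub_mem_interval_iff]
        exact fun h => hx fun j hj => (h j hj).trans (hy j hj)
      have hag : ∀ j ∈ Set.Iio N, (x - y) j = (x - u) j := fun j hj => by
        simp [hy j hj]
      rw [hnc]
      refine (norm_fejerSum_mul_M_add_le_of_notMem hm hkM.le c hxy).trans ?_
      rw [dependsOn_fejerSum hm le_rfl hag, dependsOn_fejerSum hm hkM.le hag]
      have hlt : M m N < M m (N + 1) := M_strictMono hm (Nat.lt_succ_self N)
      have h1 := norm_fejerSum_le hm hb hlt (x - u)
      have h2 := norm_fejerSum_le hm hb (hkM.trans hlt) (x - u)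
      rw [add_mul, one_mul]
      gcongr
    · rw [Set.indicator_of_notMem hy, hsupp y hy, zero_mul, norm_zero]
  refine (norm_integral_le_of_norm_le
    ((integrable_const _).indicator (measurableSet_interval m N u))
    (Eventually.of_forall hpt)).trans ?_
  rw [integral_indicator_const _ (measurableSet_interval m N u), haar_real_interval, smul_eq_mul]
  have hM : (0 : ℝ) < M m N := by exact_mod_cast M_pos N
  -- Since `n > M_N` gives `c ≥ 1`, `c + 1 ≤ 2 c`; this is where the second factor `1 / M_N` of the
  -- envelope comes from.
  have h1 : ((c : ℝ) + 1) * M m N ≤ 2 * n := by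
    have h2 : ((c * M m N + k : ℕ) : ℝ) = n := by rw [← hnc]
    have h3 : (1 : ℝ) ≤ c := by exact_mod_cast hc1
    push_cast at h2
    have h4 : (0 : ℝ) ≤ k := by positivity
    nlinarith
  have h2 : ((M m N : ℝ))⁻¹ * (H * ((c + 1) * K)) =
      (((c : ℝ) + 1) * M m N) * (H * K / (M m N : ℝ) ^ 2) := by
    field_simp
  rw [h2]
  calc _ ≤ 2 * n * (H * K / (M m N : ℝ) ^ 2) := by gcongr
    _ = _ := by rw [hK]; ring

theorem haar_envelope_le (hm : ∀ k, 2 ≤ m k) {b : ℕ} (hb : ∀ k, m k ≤ b) (N : ℕ)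
    (u : VGroup m) {h : ℝ} (hh : 0 < h) {r : ℝ≥0} (hr : 0 < r) :
    r * haar m {x | (r : ℝ≥0∞) ^ 2 < ENNReal.ofReal (envelope m b N u (h ^ 2) x)} ≤
      ENNReal.ofReal (20 * (b : ℝ) ^ 2 * h) * (M m N : ℝ≥0∞)⁻¹ := by
  have hr' : (0 : ℝ) < r := by exact_mod_cast hr
  have hM : (0 : ℝ) < M m N := by exact_mod_cast M_pos N
  have hb1 : (1 : ℝ) ≤ b := by
    have h1 := hm 0
    have h2 := hb 0
    exact_mod_cast (by omega : 1 ≤ b)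
  have hb0 : (0 : ℝ) < b := by linarith
  have hrr : (r : ℝ≥0∞) = ENNReal.ofReal r := (ENNReal.ofReal_coe_nnreal).symm
  have hconv : ∀ x, (r : ℝ≥0∞) ^ 2 < ENNReal.ofReal (envelope m b N u (h ^ 2) x) →
      (r : ℝ) ^ 2 < envelope m b N u (h ^ 2) x := by
    intro x hx
    rw [hrr, ← ENNReal.ofReal_pow hr'.le] at hx
    exact (ENNReal.ofReal_lt_ofReal_iff_of_nonneg (by positivity)).1 hx
  -- Chosen so that `4 b² h² / M_N² * 4 M_s M_B > r²` is exactly `M_s M_B > ρ²`.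
  set ρ : ℝ := r * M m N / (4 * b * h) with hρ
  have hρ0 : 0 < ρ := by positivity
  set E := {x | ∃ s B, s < B ∧ B ≤ N ∧ x - u ∈ slab m s B ∧ ρ ^ 2 < M m s * M m B} with hE
  have hoff : ∀ x, x ∉ interval m N u → (r : ℝ) ^ 2 < envelope m b N u (h ^ 2) x → x ∈ E := by
    intro x hx hrx
    rw [envelope, if_neg hx] at hrx
    obtain ⟨s, B, hsB, hBN, hmem, hle⟩ := exists_majorant_le hm
      (z := x - u) (fun h => hx (sub_mem_interval_iff.1 h))
    refine ⟨s, B, hsB, hBN, hmem, ?_⟩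
    rw [hρ, div_pow, div_lt_iff₀ (by positivity), mul_pow]
    have h1 : (r : ℝ) ^ 2 < 4 * (b : ℝ) ^ 2 * h ^ 2 / (M m N : ℝ) ^ 2 *
        (4 * (M m s * M m B)) := hrx.trans_le (by gcongr)
    calc (r : ℝ) ^ 2 * (M m N : ℝ) ^ 2 < 4 * (b : ℝ) ^ 2 * h ^ 2 / (M m N : ℝ) ^ 2 *
        (4 * (M m s * M m B)) * (M m N : ℝ) ^ 2 := by gcongr
      _ = _ := by field_simp
  have hEm : r * haar m E ≤ ENNReal.ofReal (16 * (b : ℝ) ^ 2 * h / M m N) := by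
    refine (mul_le_mul_right (haar_exists_slab_le hm hb N u hρ0) _).trans ?_
    rw [hrr, ← ENNReal.ofReal_mul hr'.le]
    refine ENNReal.ofReal_le_ofReal (le_of_eq ?_)
    rw [hρ]
    field_simp
    ring
  have hsum : ENNReal.ofReal (20 * (b : ℝ) ^ 2 * h) * (M m N : ℝ≥0∞)⁻¹ =
      ENNReal.ofReal (4 * (b : ℝ) ^ 2 * h) * (M m N : ℝ≥0∞)⁻¹ +
        ENNReal.ofReal (16 * (b : ℝ) ^ 2 * h / M m N) := by
    rw [ENNReal.ofReal_div_of_pos hM, ENNReal.ofReal_natCast, div_eq_mul_inv, ← add_mul,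
      ← ENNReal.ofReal_add (by positivity) (by positivity)]
    congr 2
    ring
  rw [hsum]
  -- The interval `I_N(u)` belongs to the level set only while `r²` is below the constant value of
  -- the envelope there, and then `r` is at most a multiple of `h`.
  by_cases hin : (r : ℝ) ^ 2 < 8 * (b : ℝ) ^ 3 * h ^ 2
  · have hsub : {x | (r : ℝ≥0∞) ^ 2 < ENNReal.ofReal (envelope m b N u (h ^ 2) x)} ⊆
        interval m N u ∪ E := by
      intro x hx
      by_cases hxi : x ∈ interval m N u
      · exact Or.inl hxi
      · exact Or.inr (hoff x hxi (hconv x hx))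
    refine (mul_le_mul_right ((measure_mono hsub).trans (measure_union_le _ _)) _).trans ?_
    rw [mul_add, haar_interval]
    refine add_le_add (mul_le_mul_left ?_ _) hEm
    rw [hrr]
    refine ENNReal.ofReal_le_ofReal (le_of_lt (lt_of_pow_lt_pow_left₀ 2 (by positivity)
      (hin.trans_le ?_)))
    have h3 : (b : ℝ) ^ 3 ≤ (b : ℝ) ^ 4 := pow_le_pow_right₀ hb1 (by norm_num)
    have h4 : (4 * (b : ℝ) ^ 2 * h) ^ 2 = 16 * (b : ℝ) ^ 4 * h ^ 2 := by ring
    rw [h4]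
    have : (0 : ℝ) ≤ (b : ℝ) ^ 4 := by positivity
    gcongr
    linarith
  · have hsub : {x | (r : ℝ≥0∞) ^ 2 < ENNReal.ofReal (envelope m b N u (h ^ 2) x)} ⊆ E := by
      intro x hx
      refine hoff x (fun hxi => hin ?_) (hconv x hx)
      have := hconv x hx
      rwa [envelope, if_pos hxi] at this
    refine (mul_le_mul_right (measure_mono hsub) _).trans (hEm.trans le_add_self)

/-- The limit defining the coefficient is attained at `L`: later increments have mean zero in a
coordinate on which `ψ_i` does not depend. -/
theorem fourierCoeff_eq (hm : ∀ k, 2 ≤ m k) {f : ℕ → VGroup m → ℂ}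
    (hf : Martingale f (filtration m) (haar m)) {i L : ℕ} (hi : i < M m L) :
    fourierCoeff m f i = ∫ x, f L x * (starRingEnd ℂ) (psi m i x) ∂haar m := by
  refine Tendsto.limUnder_eq (tendsto_const_nhds.congr' ?_)
  filter_upwards [eventually_ge_atTop L] with k hk
  symm
  induction k, hk using Nat.le_induction with
  | base => rfl
  | succ k hk ih =>
    rw [← ih, ← sub_eq_zero]
    have hψ : DependsOn (fun x => (starRingEnd ℂ) (psi m i x)) (Set.Iio k) := fun x y hxy => by
      simp only [dependsOn_psi hm (hi.trans_le (M_mono hk)) hxy]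
    have hd : DependsOn (fun x => f (k + 1) x - f k x) (Set.Iio (k + 1)) := fun x y hxy => by
      simp only [Martingale.dependsOn hf (k + 1) hxy,
        dependsOn_mono (Nat.le_succ k) (Martingale.dependsOn hf k) hxy]
    rw [← integral_sub, ← integral_mul_eq_zero hψ hd (Martingale.sum_update_sub hf k)]
    · congr 1
      ext x
      ring
    · refine integrable_of_dependsOn (n := k + 1) fun x y hxy => ?_
      simp only [Martingale.dependsOn hf (k + 1) hxy, dependsOn_mono (Nat.le_succ k) hψ hxy]
    · refine integrable_of_dependsOn (n := k) fun x y hxy => ?_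
      simp only [Martingale.dependsOn hf k hxy, hψ hxy]

theorem partialSum_eq (hm : ∀ k, 2 ≤ m k) {f : ℕ → VGroup m → ℂ}
    (hf : Martingale f (filtration m) (haar m)) {n L : ℕ} (hn : n ≤ M m L) (x : VGroup m) :
    partialSum m f n x = ∫ y, f L y * dirichlet m n (x - y) ∂haar m := by
  simp only [dirichlet, Finset.mul_sum, partialSum]
  have hdep : ∀ i < n, DependsOn (fun y => psi m i (x - y)) (Set.Iio L) := fun i hi =>
    dependsOn_comp_sub (dependsOn_psi hm (hi.trans_le hn)) x
  rw [integral_finsetSum]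
  · refine Finset.sum_congr rfl fun i hi => ?_
    rw [fourierCoeff_eq hm hf ((Finset.mem_range.1 hi).trans_le hn), ← integral_mul_const]
    congr 1
    ext y
    rw [psi_sub]
    ring
  · intro i hi
    refine integrable_of_dependsOn (n := L) fun y z hyz => ?_
    have := hdep i (Finset.mem_range.1 hi) hyz
    simp only at this
    simp only [Martingale.dependsOn hf L hyz, this]

theorem sum_partialSum_eq (hm : ∀ k, 2 ≤ m k) {f : ℕ → VGroup m → ℂ}
    (hf : Martingale f (filtration m) (haar m)) {n L : ℕ} (hn : n ≤ M m L) (x : VGroup m) :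
    ∑ k ∈ Finset.range n, partialSum m f k x =
      ∫ y, f L y * fejerSum m n (x - y) ∂haar m := by
  simp only [fejerSum, Finset.mul_sum]
  rw [integral_finsetSum]
  · exact Finset.sum_congr rfl fun k hk =>
      partialSum_eq hm hf ((Finset.mem_range.1 hk).le.trans hn) x
  · intro k hk
    refine integrable_of_dependsOn (n := L) fun y z hyz => ?_
    have := dependsOn_comp_sub (dependsOn_dirichlet hm
      ((Finset.mem_range.1 hk).le.trans hn)) x hyz
    simp only at this
    simp only [Martingale.dependsOn hf L hyz, this]

end Atoms

/-! ### Decomposition of a martingale by stopping times -/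

section Decomposition

variable {m : ℕ → ℕ} [∀ k, NeZero (m k)] {f : ℕ → VGroup m → ℂ}

/-- The predictable majorant of a martingale: it bounds `f^(0), …, f^(i+1)` and depends on the
first `i` coordinates only. -/
def predMax (f : ℕ → VGroup m → ℂ) (i : ℕ) (x : VGroup m) : ℝ≥0 :=
  (Finset.range (i + 1)).sup fun j => Finset.univ.sup fun a : ZMod (m j) =>
    ‖f (j + 1) (Function.update x j a)‖₊

theorem nnnorm_le_predMax {i j : ℕ} (hj : j ≤ i) (x : VGroup m) (a : ZMod (m j)) :
    ‖f (j + 1) (Function.update x j a)‖₊ ≤ predMax f i x :=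
  (Finset.le_sup (f := fun a : ZMod (m j) => ‖f (j + 1) (Function.update x j a)‖₊)
    (Finset.mem_univ a)).trans
    (Finset.le_sup (f := fun j => Finset.univ.sup fun a : ZMod (m j) =>
      ‖f (j + 1) (Function.update x j a)‖₊) (Finset.mem_range.2 (by omega)))

theorem predMax_mono (x : VGroup m) : Monotone fun i => predMax f i x := fun _ _ h =>
  Finset.sup_mono (Finset.range_mono (by omega))

theorem norm_succ_le_predMax {i j : ℕ} (hj : j ≤ i) (x : VGroup m) :
    ‖f (j + 1) x‖ ≤ predMax f i x := by
  have := nnnorm_le_predMax (f := f) hj x (x j)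
  rw [Function.update_eq_self] at this
  exact_mod_cast this

/-- `f 0` is the average of `f 1` over the coordinate `0`, all of whose values enter `predMax`. -/
theorem norm_zero_le_predMax (hf : Martingale f (filtration m) (haar m)) (i : ℕ)
    (x : VGroup m) : ‖f 0 x‖ ≤ predMax f i x := by
  have h := Martingale.sum_update hf 0 x
  have hm0 : (0 : ℝ) < m 0 := by exact_mod_cast Nat.pos_of_ne_zero (NeZero.ne (m 0))
  have h1 : (m 0 : ℝ) * ‖f 0 x‖ ≤ m 0 * predMax f i x := by
    calc (m 0 : ℝ) * ‖f 0 x‖ = ‖∑ a : ZMod (m 0), f (0 + 1) (Function.update x 0 a)‖ := by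
          rw [h, norm_mul, Complex.norm_natCast]
      _ ≤ ∑ a : ZMod (m 0), ‖f (0 + 1) (Function.update x 0 a)‖ := norm_sum_le _ _
      _ ≤ ∑ _a : ZMod (m 0), (predMax f i x : ℝ) :=
          Finset.sum_le_sum fun a _ => by
            exact_mod_cast nnnorm_le_predMax (f := f) (Nat.zero_le i) x a
      _ = _ := by simp [ZMod.card]
  exact le_of_mul_le_mul_left h1 hm0

theorem dependsOn_predMax (hf : Martingale f (filtration m) (haar m)) (i : ℕ) :
    DependsOn (predMax f i) (Set.Iio i) := fun x y hxy => by
  refine Finset.sup_congr rfl fun j hj => Finset.sup_congr rfl fun a _ => ?_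
  rw [Martingale.dependsOn hf (j + 1) (y := Function.update y j a)]
  intro k hk
  rcases eq_or_ne k j with rfl | hne
  · simp
  · rw [Function.update_of_ne hne, Function.update_of_ne hne, hxy k]
    have := Finset.mem_range.1 hj
    simp only [Set.mem_Iio] at hk ⊢
    omega

/-- The increments of a martingale up to time `L` while the predictable majorant is at most
`l`. -/
def stopped (f : ℕ → VGroup m → ℂ) (L : ℕ) (l : ℝ≥0) (x : VGroup m) : ℂ :=
  ∑ j ∈ Finset.range L, (if predMax f j x ≤ l then 1 else 0) * (f (j + 1) x - f j x)

theorem stopped_eq_of_le {L : ℕ} {l : ℝ≥0} {x : VGroup m}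
    (h : ∀ j < L, predMax f j x ≤ l) : stopped f L l x = f L x - f 0 x := by
  rw [stopped, ← Finset.sum_range_sub (fun j => f j x)]
  exact Finset.sum_congr rfl fun j hj => by rw [if_pos (h j (Finset.mem_range.1 hj)), one_mul]

/-- Because `predMax` increases in time, the increments are cut off once and for all, and the result
is `f j - f 0` at a time `j` whose value is still controlled by the level: predictability excludes
an overshoot. -/
theorem norm_stopped_le (hf : Martingale f (filtration m) (haar m)) (L : ℕ) (l : ℝ≥0)
    (x : VGroup m) : ‖stopped f L l x‖ ≤ 2 * l := by
  induction L with
  | zero => simp [stopped]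
  | succ L ih =>
    by_cases h : predMax f L x ≤ l
    · rw [stopped_eq_of_le fun j hj =>
        (predMax_mono x (Nat.lt_succ_iff.1 hj)).trans h, two_mul]
      have hl : (predMax f L x : ℝ) ≤ l := by exact_mod_cast h
      exact (norm_sub_le _ _).trans (add_le_add ((norm_succ_le_predMax le_rfl x).trans hl)
        ((norm_zero_le_predMax hf L x).trans hl))
    · rw [stopped, Finset.sum_range_succ, if_neg h, zero_mul, add_zero]
      exact ih

/-- The predictable majorant exceeds the level `l` at time `i`, and not before. -/
def StartsAt (f : ℕ → VGroup m → ℂ) (l : ℝ≥0) (i : ℕ) (x : VGroup m) : Prop :=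
  l < predMax f i x ∧ ∀ j < i, predMax f j x ≤ l

theorem dependsOn_startsAt (hf : Martingale f (filtration m) (haar m)) (l : ℝ≥0) (i : ℕ) :
    DependsOn (StartsAt f l i) (Set.Iio i) := fun x y hxy => by
  simp only [StartsAt, eq_iff_iff]
  rw [dependsOn_predMax hf i hxy]
  refine and_congr_right fun _ => forall₂_congr fun j hj => ?_
  rw [dependsOn_predMax hf j fun k hk => hxy k (lt_trans hk hj)]

theorem startsAt_unique {l : ℝ≥0} {i j : ℕ} {x : VGroup m} (hi : StartsAt f l i x)
    (hj : StartsAt f l j x) : i = j := by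
  rcases lt_trichotomy i j with h | h | h
  · exact absurd hi.1 (not_lt.2 (hj.2 i h))
  · exact h
  · exact absurd hj.1 (not_lt.2 (hi.2 j h))

open Classical in
/-- The part of a martingale on `I_i(u)` between the levels `l` and `l'`, when the level `l` is
first exceeded at time `i` there. -/
def atom (f : ℕ → VGroup m → ℂ) (L : ℕ) (l l' : ℝ≥0) (i : ℕ) (u : VGroup m) (x : VGroup m) : ℂ :=
  if x ∈ interval m i u ∧ StartsAt f l i u then stopped f L l' x - stopped f L l x else 0

theorem norm_atom_le (hf : Martingale f (filtration m) (haar m)) (L : ℕ) (l l' : ℝ≥0) (i : ℕ)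
    (u x : VGroup m) : ‖atom f L l l' i u x‖ ≤ 2 * l' + 2 * l := by
  rw [atom]
  split_ifs
  · exact (norm_sub_le _ _).trans
      (add_le_add (norm_stopped_le hf L l' x) (norm_stopped_le hf L l x))
  · rw [norm_zero]
    positivity

theorem dependsOn_stopped (hf : Martingale f (filtration m) (haar m)) (L : ℕ) (l : ℝ≥0) :
    DependsOn (stopped f L l) (Set.Iio L) := fun x y hxy => by
  refine Finset.sum_congr rfl fun j hj => ?_
  have hj' := Finset.mem_range.1 hj
  rw [dependsOn_mono hj'.le (dependsOn_predMax hf j) hxy,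
    dependsOn_mono hj' (Martingale.dependsOn hf (j + 1)) hxy,
    dependsOn_mono hj'.le (Martingale.dependsOn hf j) hxy]

theorem integrable_atom_mul (hm : ∀ k, 2 ≤ m k) (hf : Martingale f (filtration m) (haar m))
    {L n : ℕ} (hn : n ≤ M m L) (l l' : ℝ≥0) {i : ℕ} (hi : i ≤ L) (u x : VGroup m) :
    Integrable (fun y => atom f L l l' i u y * fejerSum m n (x - y)) (haar m) := by
  refine integrable_of_dependsOn (n := L) fun y z hyz => ?_
  have h1 : (y ∈ interval m i u) = (z ∈ interval m i u) :=
    dependsOn_mono hi (dependsOn_mem_interval i u) hyz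
  have h2 : fejerSum m n (x - y) = fejerSum m n (x - z) :=
    dependsOn_comp_sub (dependsOn_fejerSum hm hn) x hyz
  have h3 : (y ∈ interval m i u ∧ StartsAt f l i u) ↔ (z ∈ interval m i u ∧ StartsAt f l i u) :=
    and_congr_left fun _ => iff_of_eq h1
  by_cases hz : z ∈ interval m i u ∧ StartsAt f l i u
  · simp only [atom, if_pos hz, if_pos (h3.2 hz), h2, dependsOn_stopped hf L _ hyz]
  · simp only [atom, if_neg hz, if_neg fun h => hz (h3.1 h), zero_mul]

/-- Expand the atom into martingale increments. Before time `i` both levels are unexceeded on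
`I_i(u)`, so the coefficients cancel. From time `i` on, the coefficient of each increment, including
the kernel since `n ≤ M m i`, is predictable, so each term integrates to zero. -/
theorem integral_atom_mul_eq_zero (hm : ∀ k, 2 ≤ m k)
    (hf : Martingale f (filtration m) (haar m)) {L : ℕ} {l l' : ℝ≥0} (hl : l ≤ l') {i n : ℕ}
    (hn : n ≤ M m i) (u x : VGroup m) :
    ∫ y, atom f L l l' i u y * fejerSum m n (x - y) ∂haar m = 0 := by
  classical
  set c : ℕ → VGroup m → ℂ := fun j y =>
    (if y ∈ interval m i u ∧ StartsAt f l i u then 1 else 0) *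
      ((if predMax f j y ≤ l' then 1 else 0) - (if predMax f j y ≤ l then 1 else 0)) *
      fejerSum m n (x - y) with hc
  have hci : ∀ j < i, ∀ y, c j y = 0 := by
    intro j hj y
    by_cases hy : y ∈ interval m i u ∧ StartsAt f l i u
    · have h1 : predMax f j y ≤ l := by
        rw [dependsOn_predMax hf j fun k hk => hy.1 k (lt_trans hk hj)]
        exact hy.2.2 j hj
      simp [hc, h1, h1.trans hl]
    · simp [hc, hy]
  have hcd : ∀ j, i ≤ j → DependsOn (c j) (Set.Iio j) := by
    intro j hj y z hyz
    have h1 : (y ∈ interval m i u) = (z ∈ interval m i u) :=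
      dependsOn_mono hj (dependsOn_mem_interval i u) hyz
    have h2 : fejerSum m n (x - y) = fejerSum m n (x - z) :=
      dependsOn_comp_sub (dependsOn_fejerSum hm (hn.trans (M_mono hj))) x hyz
    simp only [hc, h1, h2, dependsOn_predMax hf j hyz]
  have hdd : ∀ j, DependsOn (fun y => f (j + 1) y - f j y) (Set.Iio (j + 1)) := by
    intro j y z hyz
    simp only [Martingale.dependsOn hf (j + 1) hyz,
      dependsOn_mono (Nat.le_succ j) (Martingale.dependsOn hf j) hyz]
  have e : (fun y => atom f L l l' i u y * fejerSum m n (x - y)) =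
      fun y => ∑ j ∈ Finset.range L, c j y * (f (j + 1) y - f j y) := by
    ext y
    simp only [atom, hc]
    split_ifs with hy
    · rw [stopped, stopped, ← Finset.sum_sub_distrib, Finset.sum_mul]
      refine Finset.sum_congr rfl fun j _ => ?_
      ring
    · simp
  rw [e, integral_finsetSum]
  · refine Finset.sum_eq_zero fun j _ => ?_
    rcases lt_or_ge j i with hj | hj
    · simp [hci j hj]
    · exact integral_mul_eq_zero (hcd j hj) (hdd j) (Martingale.sum_update_sub hf j)
  · intro j _
    rcases lt_or_ge j i with hj | hj
    · simp [hci j hj]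
    · refine integrable_of_dependsOn (n := j + 1) fun y z hyz => ?_
      have h1 := hdd j hyz
      simp only at h1
      simp only [h1, dependsOn_mono (Nat.le_succ j) (hcd j hj) hyz]

/-- At a given point only one time `i` and one interval can contribute: the first passage above `l`
and the interval containing the point. Without a passage before `L`, both stopped martingales equal
`f L - f 0`. -/
theorem sum_atom (hf : Martingale f (filtration m) (haar m)) (L : ℕ) {l l' : ℝ≥0}
    (hl : l ≤ l') (x : VGroup m) :
    ∑ i ∈ Finset.range L, ∑ w : (j : Fin i) → ZMod (m j), atom f L l l' i (extend w) x =
      stopped f L l' x - stopped f L l x := by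
  classical
  have h1 : ∀ i, ∑ w : (j : Fin i) → ZMod (m j), atom f L l l' i (extend w) x =
      if StartsAt f l i x then stopped f L l' x - stopped f L l x else 0 := by
    intro i
    rw [Finset.sum_eq_single (prefixOf i x)]
    · have h2 : StartsAt f l i (extend (prefixOf i x)) = StartsAt f l i x :=
        dependsOn_comp_extend (dependsOn_startsAt hf l i) x
      simp only [atom, mem_interval_extend_iff, true_and, h2]
    · intro w _ hw
      simp only [atom, mem_interval_extend_iff, hw, false_and, if_false]
    · simp
  simp only [h1]
  by_cases hex : ∃ i, i < L ∧ l < predMax f i x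
  · obtain ⟨h2, h3⟩ := Nat.find_spec hex
    have hs : StartsAt f l (Nat.find hex) x := ⟨h3, fun j hj => by
      have := Nat.find_min hex hj
      push Not at this
      exact this (hj.trans h2)⟩
    rw [Finset.sum_eq_single (Nat.find hex), if_pos hs]
    · intro j _ hj
      rw [if_neg fun h => hj (startsAt_unique h hs)]
    · intro h
      exact absurd (Finset.mem_range.2 h2) h
  · push Not at hex
    rw [stopped_eq_of_le hex, stopped_eq_of_le fun j hj => (hex j hj).trans hl, sub_self]
    simp

theorem exists_predMax_le (hf : Martingale f (filtration m) (haar m)) (L : ℕ) :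
    ∃ C : ℝ≥0, ∀ j < L, ∀ x, predMax f j x ≤ C := by
  obtain ⟨C, hC⟩ := (finite_range_of_dependsOn (dependsOn_predMax hf L)).bddAbove
  exact ⟨C, fun j hj x => (predMax_mono x hj.le).trans (hC ⟨x, rfl⟩)⟩

end Decomposition

/-! ### Weak-type bound for the Fejér means of a martingale -/

section FejerMaximal

variable {m : ℕ → ℕ} [∀ k, NeZero (m k)] {f : ℕ → VGroup m → ℂ}

theorem measurable_iSup_enorm (hf : Martingale f (filtration m) (haar m)) :
    Measurable fun x => ⨆ n, ‖f n x‖ₑ :=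
  Measurable.iSup fun n => (measurable_of_dependsOn' (Martingale.dependsOn hf n)).enorm

/-- First passage of `predMax` at `i` means that some value `a` of the `i`-th coordinate gives `‖f
(i + 1)‖ > l` on a whole subinterval of `I_i(u)`, a fraction `1 / m i ≥ 1 / b` of it. Here
boundedness of `m` makes predictable stopping affordable. -/
theorem inv_M_le_of_startsAt {b : ℕ} (hb : ∀ k, m k ≤ b)
    (hf : Martingale f (filtration m) (haar m)) {l : ℝ≥0} {i : ℕ} {u : VGroup m}
    (h : StartsAt f l i u) :
    (M m i : ℝ≥0∞)⁻¹ ≤ b * haar m (interval m i u ∩ {x | (l : ℝ≥0∞) < ⨆ n, ‖f n x‖ₑ}) := by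
  obtain ⟨j, hj, h1⟩ := Finset.lt_sup_iff.1 h.1
  obtain ⟨a, _, h2⟩ := Finset.lt_sup_iff.1 h1
  have hji : j = i := by
    by_contra hne
    have hlt : j < i := by
      have := Finset.mem_range.1 hj
      omega
    exact absurd h2 (not_lt.2 ((nnnorm_le_predMax le_rfl u a).trans (h.2 j hlt)))
  subst hji
  have hsub : interval m (j + 1) (Function.update u j a) ⊆
      interval m j u ∩ {x | (l : ℝ≥0∞) < ⨆ n, ‖f n x‖ₑ} := by
    intro y hy
    refine ⟨fun k hk => ?_, ?_⟩
    · rw [hy k (by omega), update_apply_of_lt hk]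
    · rw [Set.mem_ofPred_eq]
      refine lt_of_lt_of_le ?_ (le_iSup (fun n => ‖f n y‖ₑ) (j + 1))
      rw [Martingale.dependsOn hf (j + 1) (y := Function.update u j a) fun k hk => hy k hk]
      exact ENNReal.coe_lt_coe.2 h2
  refine le_trans ?_ (mul_le_mul_right (measure_mono hsub) _)
  rw [haar_interval, M_succ]
  have hmj : (m j : ℝ≥0∞) ≠ 0 := by exact_mod_cast NeZero.ne (m j)
  push_cast
  rw [ENNReal.mul_inv (Or.inr (by simp)) (Or.inr hmj), mul_left_comm]
  refine le_mul_of_one_le_right (zero_le) ?_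
  rw [← div_eq_mul_inv, ENNReal.le_div_iff_mul_le (Or.inl hmj) (Or.inl (by simp)), one_mul]
  exact_mod_cast hb j

theorem sum_haar_le_of_pairwise_disjoint {ι : Type*} (S : Finset ι) {s : ι → Set (VGroup m)}
    {t : Set (VGroup m)} (hs : ∀ i ∈ S, MeasurableSet (s i))
    (hd : ∀ i ∈ S, ∀ j ∈ S, i ≠ j → Disjoint (s i) (s j)) (ht : ∀ i ∈ S, s i ⊆ t) :
    ∑ i ∈ S, haar m (s i) ≤ haar m t := by
  rw [← measure_biUnion_finset (fun i hi j hj hij => hd i hi j hj hij) hs]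
  exact measure_mono (Set.iUnion₂_subset ht)

-- The total measure of the stopping intervals is charged to the level set of the maximal function:
-- they are disjoint for a fixed time, and for different times by uniqueness of the first passage.
open Classical in
theorem sum_startsAt_le {b : ℕ} (hb : ∀ k, m k ≤ b)
    (hf : Martingale f (filtration m) (haar m)) (l : ℝ≥0) (L : ℕ) :
    ∑ i ∈ Finset.range L, ∑ w : (j : Fin i) → ZMod (m j),
      (if StartsAt f l i (extend w) then (M m i : ℝ≥0∞)⁻¹ else 0) ≤
        b * haar m {x | (l : ℝ≥0∞) < ⨆ n, ‖f n x‖ₑ} := by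
  set T : Set (VGroup m) := {x | (l : ℝ≥0∞) < ⨆ n, ‖f n x‖ₑ} with hT
  have hTm : MeasurableSet T := measurableSet_lt measurable_const (measurable_iSup_enorm hf)
  have hSm : ∀ i, MeasurableSet {x | StartsAt f l i x} := fun i =>
    measurableSet_setOfPred.2 (measurable_of_dependsOn' (dependsOn_startsAt hf l i))
  have hterm : ∀ (i : ℕ) (w : (j : Fin i) → ZMod (m j)),
      (if StartsAt f l i (extend w) then (M m i : ℝ≥0∞)⁻¹ else 0) ≤
        b * haar m (interval m i (extend w) ∩ ({x | StartsAt f l i x} ∩ T)) := by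
    intro i w
    split_ifs with h
    · refine (inv_M_le_of_startsAt hb hf h).trans (mul_le_mul_right (measure_mono ?_) _)
      rintro x ⟨hx, hxT⟩
      exact ⟨hx, (dependsOn_startsAt hf l i fun k hk => hx k hk).mpr h, hxT⟩
    · exact zero_le
  calc _ ≤ ∑ i ∈ Finset.range L, ∑ w : (j : Fin i) → ZMod (m j),
        b * haar m (interval m i (extend w) ∩ ({x | StartsAt f l i x} ∩ T)) :=
        Finset.sum_le_sum fun i _ => Finset.sum_le_sum fun w _ => hterm i w
    _ ≤ ∑ i ∈ Finset.range L, b * haar m ({x | StartsAt f l i x} ∩ T) := by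
        refine Finset.sum_le_sum fun i _ => ?_
        rw [← Finset.mul_sum]
        refine mul_le_mul_right (sum_haar_le_of_pairwise_disjoint _
          (fun w _ => (measurableSet_interval _ _ _).inter ((hSm i).inter hTm))
          (fun v _ w _ hvw => ?_) fun w _ => Set.inter_subset_right) _
        exact (pairwise_disjoint_interval_extend i hvw).mono Set.inter_subset_left
          Set.inter_subset_left
    _ ≤ b * haar m T := by
        rw [← Finset.mul_sum]
        refine mul_le_mul_right (sum_haar_le_of_pairwise_disjoint _
          (fun i _ => (hSm i).inter hTm) (fun i _ j _ hij => ?_)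
          fun i _ => Set.inter_subset_right) _
        exact Set.disjoint_left.2 fun x hi hj => hij (startsAt_unique hi.1 hj.1)

theorem sum_two_pow_mul_le (δ : ℝ≥0) (K : ℕ) :
    ∑ k ∈ Finset.range (K + 1), (δ * 2 ^ k : ℝ≥0) ≤ 2 * (δ * 2 ^ K) := by
  induction K with
  | zero => simp; exact le_mul_of_one_le_left zero_le (by norm_num)
  | succ K ih =>
    rw [Finset.sum_range_succ]
    refine (add_le_add_left ih _).trans (le_of_eq ?_)
    ring

/-- The levels `δ 2^k` below `v^{1/2}` form a geometric progression dominated by its largest member.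
-/
theorem sum_levels_le (δ : ℝ≥0) (K : ℕ) (v : ℝ≥0∞) :
    ∑ k ∈ Finset.range K, (if (((δ * 2 ^ k) ^ 2 : ℝ≥0) : ℝ≥0∞) < v
      then ((δ * 2 ^ k : ℝ≥0) : ℝ≥0∞) else 0) ≤ 2 * v ^ (1 / 2 : ℝ) := by
  induction K with
  | zero => simp
  | succ K ih =>
    by_cases h : (((δ * 2 ^ K) ^ 2 : ℝ≥0) : ℝ≥0∞) < v
    · have h1 : ((δ * 2 ^ K : ℝ≥0) : ℝ≥0∞) ≤ v ^ (1 / 2 : ℝ) := by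
        rw [one_div, ENNReal.le_rpow_inv_iff (by norm_num)]
        have : ((δ * 2 ^ K : ℝ≥0) : ℝ≥0∞) ^ (2 : ℝ) = (((δ * 2 ^ K) ^ 2 : ℝ≥0) : ℝ≥0∞) := by
          rw [ENNReal.rpow_ofNat, ENNReal.coe_pow]
        rw [this]
        exact h.le
      calc _ ≤ ∑ k ∈ Finset.range (K + 1), ((δ * 2 ^ k : ℝ≥0) : ℝ≥0∞) := by
            refine Finset.sum_le_sum fun k _ => ?_
            split_ifs
            · exact le_rfl
            · exact zero_le
        _ ≤ ((2 * (δ * 2 ^ K) : ℝ≥0) : ℝ≥0∞) := by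
            exact_mod_cast sum_two_pow_mul_le δ K
        _ = 2 * ((δ * 2 ^ K : ℝ≥0) : ℝ≥0∞) := by rw [ENNReal.coe_mul]; rfl
        _ ≤ _ := mul_le_mul_right h1 _
    · rw [Finset.sum_range_succ, if_neg h, add_zero]
      exact ih

theorem sum_haar_levels_le (hf : Martingale f (filtration m) (haar m)) (δ : ℝ≥0) (K : ℕ) :
    ∑ k ∈ Finset.range K, ((δ * 2 ^ k : ℝ≥0) : ℝ≥0∞) *
      haar m {x | (((δ * 2 ^ k) ^ 2 : ℝ≥0) : ℝ≥0∞) < ⨆ n, ‖f n x‖ₑ} ≤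
        2 * ∫⁻ x, (⨆ n, ‖f n x‖ₑ) ^ (1 / 2 : ℝ) ∂haar m := by
  have hmeas : ∀ k : ℕ, MeasurableSet {x | (((δ * 2 ^ k) ^ 2 : ℝ≥0) : ℝ≥0∞) < ⨆ n, ‖f n x‖ₑ} :=
    fun k => measurableSet_lt measurable_const (measurable_iSup_enorm hf)
  rw [← lintegral_const_mul _ ((measurable_iSup_enorm hf).pow_const _)]
  simp_rw [← lintegral_indicator_const (hmeas _)]
  rw [← lintegral_finsetSum _ fun k _ => measurable_const.indicator (hmeas k)]
  refine lintegral_mono fun x => le_trans (le_of_eq ?_) (sum_levels_le δ K _)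
  refine Finset.sum_congr rfl fun k _ => ?_
  by_cases h : (((δ * 2 ^ k) ^ 2 : ℝ≥0) : ℝ≥0∞) < ⨆ n, ‖f n x‖ₑ
  · rw [if_pos h, Set.indicator_of_mem (Set.mem_ofPred_eq ▸ h)]
  · rw [if_neg h, Set.indicator_of_notMem (Set.mem_ofPred_eq ▸ h)]

/-- `f 0` is constant, so the integral bounds its square root directly. -/
theorem norm_zero_le_sq (hf : Martingale f (filtration m) (haar m)) {δ : ℝ≥0}
    (hδ : ∫⁻ x, (⨆ n, ‖f n x‖ₑ) ^ (1 / 2 : ℝ) ∂haar m ≤ δ) (x : VGroup m) :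
    ‖f 0 x‖ ≤ (δ : ℝ) ^ 2 := by
  have h1 : ‖f 0 x‖ₑ ^ (1 / 2 : ℝ) ≤ δ := by
    refine le_trans ?_ hδ
    calc ‖f 0 x‖ₑ ^ (1 / 2 : ℝ) = ∫⁻ _, ‖f 0 x‖ₑ ^ (1 / 2 : ℝ) ∂haar m := by simp
      _ ≤ _ := by
        refine lintegral_mono fun y => ENNReal.rpow_le_rpow ?_ (by norm_num)
        rw [Martingale.dependsOn hf 0 (x := x) (y := y) fun k hk => absurd hk (by simp)]
        exact le_iSup (fun n => ‖f n y‖ₑ) 0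
  rw [one_div, ENNReal.rpow_inv_le_iff (by norm_num), ENNReal.rpow_ofNat] at h1
  have h2 : ‖f 0 x‖₊ ≤ δ ^ 2 := by
    rw [← ENNReal.coe_le_coe, ENNReal.coe_pow]
    exact h1
  exact_mod_cast h2

theorem weak_half_add_le {α : Type*} [MeasurableSpace α] {μ : Measure α} {g h : α → ℝ≥0∞}
    (hg : Measurable g) (hh : Measurable h) {A B : ℝ≥0∞}
    (hA : ∀ r : ℝ≥0, 0 < r → r * μ {x | (r : ℝ≥0∞) ^ 2 < g x} ≤ A)
    (hB : ∀ r : ℝ≥0, 0 < r → r * μ {x | (r : ℝ≥0∞) ^ 2 < h x} ≤ B) {r : ℝ≥0} (hr : 0 < r) :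
    r * μ {x | (r : ℝ≥0∞) ^ 2 < g x + h x} ≤ 5 * (A + B) := by
  have := weak_half_sum_le (μ := μ) (Finset.univ : Finset (Fin 2)) (g := ![g, h]) (A := ![A, B])
    (fun i _ => by fin_cases i <;> assumption) (fun i _ => by fin_cases i <;> assumption) hr
  simpa [Fin.sum_univ_two] using this

open Classical in
/-- The pointwise bound of the Fejér means that results from the decomposition into atoms. -/
def fejerBound (f : ℕ → VGroup m → ℂ) (b L K : ℕ) (δ : ℝ≥0) (x : VGroup m) : ℝ≥0∞ :=
  ENNReal.ofReal (8 * (b : ℝ) ^ 3 * (3 * (δ : ℝ) ^ 2)) +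
    ∑ k ∈ Finset.range K, ∑ i ∈ Finset.range L, ∑ w : (j : Fin i) → ZMod (m j),
      if StartsAt f ((δ * 2 ^ k) ^ 2) i (extend w)
      then ENNReal.ofReal (envelope m b i (extend w) ((4 * (δ * 2 ^ k)) ^ 2) x) else 0

theorem enorm_sum_partialSum_le (hm : ∀ k, 2 ≤ m k) {b : ℕ} (hb : ∀ k, m k ≤ b)
    (hf : Martingale f (filtration m) (haar m)) {δ : ℝ≥0}
    (hδ : ∫⁻ x, (⨆ n, ‖f n x‖ₑ) ^ (1 / 2 : ℝ) ∂haar m ≤ δ) {L K : ℕ}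
    (hK : ∀ j < L, ∀ x, predMax f j x ≤ (δ * 2 ^ K) ^ 2) {n : ℕ} (hn : n ≤ M m L)
    (x : VGroup m) :
    ‖∑ k ∈ Finset.range n, partialSum m f k x‖ₑ ≤ n * fejerBound f b L K δ x := by
  classical
  set l : ℕ → ℝ≥0 := fun k => (δ * 2 ^ k) ^ 2 with hl
  have hll : ∀ k, l k ≤ l (k + 1) := fun k => by
    simp only [hl]
    gcongr
    · norm_num
    · omega
  -- Telescope over the levels; by `hK` the last level is never exceeded before `L`, so there the
  -- stopped martingale is `f L - f 0`.
  have hdec : ∀ y, f L y = (f 0 y + stopped f L (l 0) y) + ∑ k ∈ Finset.range K,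
      ∑ i ∈ Finset.range L, ∑ w : (j : Fin i) → ZMod (m j),
        atom f L (l k) (l (k + 1)) i (extend w) y := by
    intro y
    rw [Finset.sum_congr rfl fun k _ => sum_atom hf L (hll k) y,
      Finset.sum_range_sub (fun k => stopped f L (l k) y), stopped_eq_of_le (l := l K)
      fun j hj => hK j hj y]
    ring
  have hgood : ∀ y, ‖f 0 y + stopped f L (l 0) y‖ ≤ 3 * (δ : ℝ) ^ 2 := by
    intro y
    have h1 := norm_zero_le_sq hf hδ y
    have h2 := norm_stopped_le hf L (l 0) y
    have h3 : ((l 0 : ℝ≥0) : ℝ) = (δ : ℝ) ^ 2 := by simp [hl]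
    rw [h3] at h2
    exact (norm_add_le _ _).trans (by linarith)
  have hgi : Integrable (fun y => (f 0 y + stopped f L (l 0) y) * fejerSum m n (x - y))
      (haar m) := by
    refine integrable_of_dependsOn (n := L) fun y z hyz => ?_
    have h2 : fejerSum m n (x - y) = fejerSum m n (x - z) :=
      dependsOn_comp_sub (dependsOn_fejerSum hm hn) x hyz
    simp only [dependsOn_mono (Nat.zero_le L) (Martingale.dependsOn hf 0) hyz,
      dependsOn_stopped hf L _ hyz, h2]
  have hai : ∀ k, ∀ i ∈ Finset.range L, ∀ w : (j : Fin i) → ZMod (m j), Integrable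
      (fun y => atom f L (l k) (l (k + 1)) i (extend w) y * fejerSum m n (x - y)) (haar m) :=
    fun k i hi w => integrable_atom_mul hm hf hn _ _ (Finset.mem_range.1 hi).le _ x
  have hint : ∑ k ∈ Finset.range n, partialSum m f k x =
      ∫ y, (f 0 y + stopped f L (l 0) y) * fejerSum m n (x - y) ∂haar m +
      ∑ k ∈ Finset.range K, ∑ i ∈ Finset.range L, ∑ w : (j : Fin i) → ZMod (m j),
        ∫ y, atom f L (l k) (l (k + 1)) i (extend w) y * fejerSum m n (x - y) ∂haar m := by
    rw [sum_partialSum_eq hm hf hn]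
    simp_rw [hdec, add_mul _ (Finset.sum _ _), Finset.sum_mul]
    rw [integral_add hgi (integrable_finsetSum _ fun k _ => integrable_finsetSum _ fun i hi =>
      integrable_finsetSum _ fun w _ => hai k i hi w), integral_finsetSum _ fun k _ =>
      integrable_finsetSum _ fun i hi => integrable_finsetSum _ fun w _ => hai k i hi w]
    congr 1
    refine Finset.sum_congr rfl fun k _ => ?_
    rw [integral_finsetSum _ fun i hi => integrable_finsetSum _ fun w _ => hai k i hi w]
    refine Finset.sum_congr rfl fun i hi => ?_
    rw [integral_finsetSum _ fun w _ => hai k i hi w]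
  have hconv : ∀ {z : ℂ} {c : ℝ}, ‖z‖ ≤ n * c → ‖z‖ₑ ≤ n * ENNReal.ofReal c := by
    intro z c h
    rw [← ofReal_norm, ← ENNReal.ofReal_natCast n, ← ENNReal.ofReal_mul (by positivity)]
    exact ENNReal.ofReal_le_ofReal h
  rw [hint, fejerBound, mul_add]
  refine (enorm_add_le _ _).trans (add_le_add (hconv ?_) ?_)
  · rw [mul_comm (n : ℝ)]
    exact norm_integral_mul_fejerSum_le hm hb hgood n x
  · rw [Finset.mul_sum]
    refine (enorm_sum_le _ _).trans (Finset.sum_le_sum fun k _ => ?_)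
    rw [Finset.mul_sum]
    refine (enorm_sum_le _ _).trans (Finset.sum_le_sum fun i _ => ?_)
    rw [Finset.mul_sum]
    refine (enorm_sum_le _ _).trans (Finset.sum_le_sum fun w _ => ?_)
    split_ifs with hs
    · refine hconv (norm_integral_mul_fejerSum_le_envelope hm hb (fun y => ?_) (fun y hy => ?_)
        (fun n hn x => integral_atom_mul_eq_zero hm hf (hll k) hn _ x) n x)
      · refine (norm_atom_le hf L _ _ i _ y).trans ?_
        simp only [hl]
        push_cast
        rw [pow_succ]
        have : 0 ≤ ((δ : ℝ) * 2 ^ k) ^ 2 := by positivity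
        -- Neighbouring levels differ by the factor `4`, which gives `2 * 4 + 2 = 10`, rounded up to
        -- a square so that the height has the form `h²`.
        calc _ = 10 * ((δ : ℝ) * 2 ^ k) ^ 2 := by ring
          _ ≤ 16 * ((δ : ℝ) * 2 ^ k) ^ 2 := by linarith
          _ = _ := by ring
      · rw [atom, if_neg fun h => hy h.1]
    · have : ∀ y, atom f L (l k) (l (k + 1)) i (extend w) y = 0 := fun y => by
        rw [atom, if_neg fun h => hs h.2]
      simp [this]

theorem haar_fejerBound_le (hm : ∀ k, 2 ≤ m k) {b : ℕ} (hb : ∀ k, m k ≤ b)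
    (hf : Martingale f (filtration m) (haar m)) {δ : ℝ≥0} (hδ0 : 0 < δ)
    (hδ : ∫⁻ x, (⨆ n, ‖f n x‖ₑ) ^ (1 / 2 : ℝ) ∂haar m ≤ δ) (L K : ℕ) {r : ℝ≥0} (hr : 0 < r) :
    r * haar m {x | (r : ℝ≥0∞) ^ 2 < fejerBound f b L K δ x} ≤
      ((5 * (5 * b ^ 2 + 20000 * b ^ 3) : ℕ) : ℝ≥0∞) * δ := by
  classical
  have hb1 : (1 : ℝ) ≤ b := by
    have h1 := hm 0
    have h2 := hb 0
    exact_mod_cast (by omega : 1 ≤ b)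
  set E : (k i : ℕ) → ((j : Fin i) → ZMod (m j)) → VGroup m → ℝ≥0∞ := fun k i w x =>
    if StartsAt f ((δ * 2 ^ k) ^ 2) i (extend w)
      then ENNReal.ofReal (envelope m b i (extend w) ((4 * (δ * 2 ^ k)) ^ 2) x) else 0 with hE
  have hEm : ∀ k i w, Measurable (E k i w) := fun k i w => by
    simp only [hE]
    split_ifs
    · exact (measurable_of_dependsOn' (dependsOn_envelope b i _ _)).ennreal_ofReal
    · exact measurable_const
  set A : (k i : ℕ) → ((j : Fin i) → ZMod (m j)) → ℝ≥0∞ := fun k i w =>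
    ((80 * b ^ 2 : ℕ) : ℝ≥0∞) * ((δ * 2 ^ k : ℝ≥0) : ℝ≥0∞) *
      (if StartsAt f ((δ * 2 ^ k) ^ 2) i (extend w) then (M m i : ℝ≥0∞)⁻¹ else 0) with hA
  have hEA : ∀ k i w, ∀ r : ℝ≥0, 0 < r →
      r * haar m {x | (r : ℝ≥0∞) ^ 2 < E k i w x} ≤ A k i w := by
    intro k i w r hr
    simp only [hE, hA]
    split_ifs with hs
    · refine (haar_envelope_le hm hb i (extend w) (h := 4 * (δ * 2 ^ k)) (by positivity)
        hr).trans (le_of_eq ?_)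
      congr 1
      rw [← ENNReal.ofReal_natCast, ← ENNReal.ofReal_coe_nnreal (p := δ * 2 ^ k),
        ← ENNReal.ofReal_mul (by positivity)]
      congr 1
      push_cast
      ring
    · simp
  -- The triple sum is assembled in three stages, over intervals, times and levels, each costing a
  -- factor `5`; the constant term below costs a fourth.
  have hlocal := fun k i => fun (r : ℝ≥0) (hr : 0 < r) =>
    weak_half_sum_le (μ := haar m) (Finset.univ : Finset ((j : Fin i) → ZMod (m j)))
    (fun w _ => hEm k i w) (fun w _ => hEA k i w) hr
  have hlevel := fun k => fun (r : ℝ≥0) (hr : 0 < r) =>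
    weak_half_sum_le (μ := haar m) (Finset.range L)
    (fun i _ => Finset.measurable_fun_sum Finset.univ fun w _ => hEm k i w)
    (fun i _ => hlocal k i) hr
  have hall := fun (r : ℝ≥0) (hr : 0 < r) =>
    weak_half_sum_le (μ := haar m) (Finset.range K)
    (fun k _ => Finset.measurable_fun_sum (Finset.range L) fun i _ =>
      Finset.measurable_fun_sum Finset.univ fun w _ => hEm k i w)
    (fun k _ => hlevel k) hr
  -- A constant exceeds `r²` only if `r² < 24 b³ δ²`, hence `r ≤ 5 b² δ`, and the measure is at most
  -- `1`.
  have hconst : ∀ r : ℝ≥0, 0 < r → r * haar m {x : VGroup m | (r : ℝ≥0∞) ^ 2 <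
      ENNReal.ofReal (8 * (b : ℝ) ^ 3 * (3 * (δ : ℝ) ^ 2))} ≤ ((5 * b ^ 2 : ℕ) : ℝ≥0∞) * δ := by
    intro r hr
    by_cases h : (r : ℝ≥0∞) ^ 2 < ENNReal.ofReal (8 * (b : ℝ) ^ 3 * (3 * (δ : ℝ) ^ 2))
    · refine (mul_le_of_le_one_right zero_le prob_le_one).trans ?_
      rw [← ENNReal.ofReal_coe_nnreal, ← ENNReal.ofReal_pow (by positivity)] at h
      have h1 := (ENNReal.ofReal_lt_ofReal_iff_of_nonneg (by positivity)).1 h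
      have h2 : (r : ℝ) ≤ 5 * (b : ℝ) ^ 2 * δ := by
        refine le_of_lt (lt_of_pow_lt_pow_left₀ 2 (by positivity) (h1.trans_le ?_))
        have h3 : (b : ℝ) ^ 3 ≤ (b : ℝ) ^ 4 := pow_le_pow_right₀ hb1 (by norm_num)
        have h4 : (5 * (b : ℝ) ^ 2 * δ) ^ 2 = 25 * ((b : ℝ) ^ 4 * δ ^ 2) := by ring
        have h5 : (b : ℝ) ^ 3 * (δ : ℝ) ^ 2 ≤ (b : ℝ) ^ 4 * δ ^ 2 := by gcongr
        have h6 : 0 ≤ (b : ℝ) ^ 4 * (δ : ℝ) ^ 2 := by positivity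
        rw [h4]
        linarith
      have h3 : r ≤ ((5 * b ^ 2 : ℕ) : ℝ≥0) * δ := by
        rw [← NNReal.coe_le_coe]
        push_cast
        exact h2
      exact_mod_cast ENNReal.coe_le_coe.2 h3
    · rw [Set.eq_empty_of_forall_notMem (s := {x : VGroup m | (r : ℝ≥0∞) ^ 2 <
        ENNReal.ofReal (8 * (b : ℝ) ^ 3 * (3 * (δ : ℝ) ^ 2))}) fun _ => h, measure_empty, mul_zero]
      exact zero_le
  have hEsum : Measurable fun x => ∑ k ∈ Finset.range K, ∑ i ∈ Finset.range L,
      ∑ w : (j : Fin i) → ZMod (m j), E k i w x :=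
    Finset.measurable_fun_sum _ fun k _ => Finset.measurable_fun_sum _ fun i _ =>
      Finset.measurable_fun_sum Finset.univ fun w _ => hEm k i w
  refine (weak_half_add_le measurable_const hEsum hconst hall hr).trans ?_
  have hsum : ∑ k ∈ Finset.range K, ∑ i ∈ Finset.range L, ∑ w : (j : Fin i) → ZMod (m j),
      A k i w ≤ ((160 * b ^ 3 : ℕ) : ℝ≥0∞) * δ := by
    calc _ = ∑ k ∈ Finset.range K, ((80 * b ^ 2 : ℕ) : ℝ≥0∞) * ((δ * 2 ^ k : ℝ≥0) : ℝ≥0∞) *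
          ∑ i ∈ Finset.range L, ∑ w : (j : Fin i) → ZMod (m j),
            (if StartsAt f ((δ * 2 ^ k) ^ 2) i (extend w) then (M m i : ℝ≥0∞)⁻¹ else 0) := by
          simp only [hA, Finset.mul_sum]
      _ ≤ ∑ k ∈ Finset.range K, ((80 * b ^ 2 : ℕ) : ℝ≥0∞) * ((δ * 2 ^ k : ℝ≥0) : ℝ≥0∞) *
          (b * haar m {x | (((δ * 2 ^ k) ^ 2 : ℝ≥0) : ℝ≥0∞) < ⨆ n, ‖f n x‖ₑ}) :=
          Finset.sum_le_sum fun k _ => mul_le_mul_right (sum_startsAt_le hb hf _ L) _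
      _ = ((80 * b ^ 3 : ℕ) : ℝ≥0∞) * ∑ k ∈ Finset.range K, ((δ * 2 ^ k : ℝ≥0) : ℝ≥0∞) *
          haar m {x | (((δ * 2 ^ k) ^ 2 : ℝ≥0) : ℝ≥0∞) < ⨆ n, ‖f n x‖ₑ} := by
          rw [Finset.mul_sum]
          refine Finset.sum_congr rfl fun k _ => ?_
          generalize haar m _ = z
          push_cast
          ring
      _ ≤ ((80 * b ^ 3 : ℕ) : ℝ≥0∞) * (2 * δ) :=
          mul_le_mul_right ((sum_haar_levels_le hf δ K).trans (mul_le_mul_right hδ _)) _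
      _ = _ := by push_cast; ring
  simp only [← Finset.mul_sum]
  refine (mul_le_mul_right (add_le_add_right (mul_le_mul_right (mul_le_mul_right
    (mul_le_mul_right hsum _) _) _) _) _).trans (le_of_eq ?_)
  push_cast
  ring

end FejerMaximal

/-! ### From Fejér means to `T` means; the bound at `p = 1/2` -/

section TMeans

variable {m : ℕ → ℕ} [∀ k, NeZero (m k)] {f : ℕ → VGroup m → ℂ}

theorem sum_mul_eq_by_parts (q : ℕ → ℝ) (S : ℕ → ℂ) (n : ℕ) :
    ∑ k ∈ Finset.range (n + 1), (q k : ℂ) * S k =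
      q n * ∑ k ∈ Finset.range (n + 1), S k -
        ∑ j ∈ Finset.range n, ((q (j + 1) - q j : ℝ) : ℂ) * ∑ k ∈ Finset.range (j + 1), S k := by
  induction n with
  | zero => simp
  | succ n ih =>
    rw [Finset.sum_range_succ, ih, Finset.sum_range_succ _ (n + 1),
      Finset.sum_range_succ (fun j => ((q (j + 1) - q j : ℝ) : ℂ) *
        ∑ k ∈ Finset.range (j + 1), S k) n]
    push_cast
    ring

/-- After summation by parts, monotonicity makes the absolute values of the differences of `q`
telescope to `q n - q 0`. -/
theorem norm_sum_mul_le {q : ℕ → ℝ} (hq : Monotone q) (hq0 : 0 ≤ q 0) (S : ℕ → ℂ) {B : ℝ}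
    {n : ℕ} (hB : ∀ j ≤ n + 1, ‖∑ k ∈ Finset.range j, S k‖ ≤ j * B) :
    ‖∑ k ∈ Finset.range (n + 1), (q k : ℂ) * S k‖ ≤ 2 * ((n + 1) * q n) * B := by
  have hqn : 0 ≤ q n := hq0.trans (hq (Nat.zero_le n))
  have hB0 : 0 ≤ B := by
    have := (norm_nonneg _).trans (hB 1 (by omega))
    simpa using this
  rw [sum_mul_eq_by_parts]
  have h1 : ‖(q n : ℂ) * ∑ k ∈ Finset.range (n + 1), S k‖ ≤ q n * ((n + 1) * B) := by
    rw [norm_mul, Complex.norm_real, Real.norm_of_nonneg hqn]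
    refine mul_le_mul_of_nonneg_left ?_ hqn
    exact_mod_cast hB (n + 1) le_rfl
  have h2 : ‖∑ j ∈ Finset.range n, ((q (j + 1) - q j : ℝ) : ℂ) *
      ∑ k ∈ Finset.range (j + 1), S k‖ ≤ q n * ((n + 1) * B) := by
    calc _ ≤ ∑ j ∈ Finset.range n, (q (j + 1) - q j) * ((n + 1) * B) := by
          refine (norm_sum_le _ _).trans (Finset.sum_le_sum fun j hj => ?_)
          have hj' := Finset.mem_range.1 hj
          have hd : 0 ≤ q (j + 1) - q j := sub_nonneg.2 (hq (Nat.le_succ j))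
          rw [norm_mul, Complex.norm_real, Real.norm_of_nonneg hd]
          refine mul_le_mul_of_nonneg_left ((hB (j + 1) (by omega)).trans ?_) hd
          have : ((j + 1 : ℕ) : ℝ) ≤ n + 1 := by exact_mod_cast (by omega : j + 1 ≤ n + 1)
          gcongr
      _ = (q n - q 0) * ((n + 1) * B) := by
          rw [← Finset.sum_mul, Finset.sum_range_sub]
      _ ≤ _ := by
          gcongr
          linarith
  refine (norm_sub_le _ _).trans ((add_le_add h1 h2).trans (le_of_eq (by ring)))

theorem mul_le_Q {q : ℕ → ℝ} (hq : Monotone q) (n : ℕ) : n * q 0 ≤ Q q n := by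
  rw [Q]
  refine le_trans (le_of_eq ?_) (Finset.card_nsmul_le_sum (Finset.range n) q (q 0)
    fun k _ => hq (Nat.zero_le k))
  simp

/-- The asymptotic condition covers large indices; the finitely many others are covered by `q N / q
0`, since `Q q n ≥ n q 0`. -/
theorem exists_mul_le_Q {q : ℕ → ℝ} (hq : Monotone q) (hq0 : 0 < q 0)
    (hO : (fun n : ℕ => q (n - 1) / Q q n) =O[atTop] (fun n : ℕ => 1 / (n : ℝ))) :
    ∃ C : ℝ≥0, ∀ n : ℕ, (n + 1) * q n ≤ C * Q q (n + 1) := by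
  obtain ⟨C, hC⟩ := hO.bound
  obtain ⟨N, hN⟩ := eventually_atTop.1 hC
  have hqp : ∀ n, 0 < q n := fun n => hq0.trans_le (hq (Nat.zero_le n))
  have hQp : ∀ n : ℕ, 0 < Q q (n + 1) := fun n =>
    lt_of_lt_of_le (by positivity) (mul_le_Q hq (n + 1))
  refine ⟨Real.toNNReal (max C (q N / q 0)), fun n => ?_⟩
  rw [Real.coe_toNNReal _ (le_max_of_le_right (div_nonneg (hqp N).le hq0.le))]
  rcases le_or_gt N (n + 1) with h | h
  · have h1 := hN (n + 1) h
    have h2 : (0 : ℝ) < n + 1 := by positivity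
    rw [Nat.add_sub_cancel, Real.norm_of_nonneg (div_nonneg (hqp n).le (hQp n).le),
      Real.norm_of_nonneg (by positivity), div_le_iff₀ (hQp n)] at h1
    push_cast at h1
    calc (n + 1) * q n ≤ (n + 1) * (C * (1 / (n + 1)) * Q q (n + 1)) := by gcongr
      _ = C * Q q (n + 1) := by field_simp
      _ ≤ _ := by
        gcongr
        · exact (hQp n).le
        · exact le_max_left _ _
  · have h1 : q n ≤ q N := hq (by omega)
    have h2 := mul_le_Q hq (n + 1)
    push_cast at h2
    calc (n + 1) * q n ≤ (n + 1) * q N := by gcongr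
      _ = q N / q 0 * ((n + 1) * q 0) := by field_simp
      _ ≤ q N / q 0 * Q q (n + 1) := by
        have := (hqp N).le
        gcongr
      _ ≤ _ := by
        gcongr
        · exact (hQp n).le
        · exact le_max_right _ _

theorem fejerBound_ne_top (b L K : ℕ) (δ : ℝ≥0) (x : VGroup m) :
    fejerBound f b L K δ x ≠ ∞ := by
  refine ENNReal.add_ne_top.2 ⟨ENNReal.ofReal_ne_top, ?_⟩
  refine ENNReal.sum_ne_top.2 fun k _ => ENNReal.sum_ne_top.2 fun i _ =>
    ENNReal.sum_ne_top.2 fun w _ => ?_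
  split_ifs
  · exact ENNReal.ofReal_ne_top
  · exact ENNReal.zero_ne_top

theorem enorm_tMean_le (hm : ∀ k, 2 ≤ m k) {b : ℕ} (hb : ∀ k, m k ≤ b)
    (hf : Martingale f (filtration m) (haar m)) {q : ℕ → ℝ} (hq : Monotone q) (hq0 : 0 < q 0)
    {C : ℝ≥0} (hC : ∀ n : ℕ, (n + 1) * q n ≤ C * Q q (n + 1)) {δ : ℝ≥0}
    (hδ : ∫⁻ x, (⨆ n, ‖f n x‖ₑ) ^ (1 / 2 : ℝ) ∂haar m ≤ δ) {L K : ℕ}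
    (hK : ∀ j < L, ∀ x, predMax f j x ≤ (δ * 2 ^ K) ^ 2) {n : ℕ} (hn : n ≤ M m L)
    (x : VGroup m) :
    ‖tMean m q f n x‖ₑ ≤ ((2 * C : ℝ≥0) : ℝ≥0∞) * fejerBound f b L K δ x := by
  rcases n with _ | n
  · simp [tMean]
  set B := (fejerBound f b L K δ x).toReal with hB
  have hBE : ENNReal.ofReal B = fejerBound f b L K δ x :=
    ENNReal.ofReal_toReal (fejerBound_ne_top b L K δ x)
  have hB0 : 0 ≤ B := ENNReal.toReal_nonneg
  have h1 : ∀ j ≤ n + 1, ‖∑ k ∈ Finset.range j, partialSum m f k x‖ ≤ j * B := by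
    intro j hj
    have h := enorm_sum_partialSum_le hm hb hf hδ hK (hj.trans hn) x
    rw [← hBE, ← ofReal_norm, ← ENNReal.ofReal_natCast j,
      ← ENNReal.ofReal_mul (by positivity)] at h
    exact (ENNReal.ofReal_le_ofReal_iff (by positivity)).1 h
  have h2 := norm_sum_mul_le hq hq0.le (fun k => partialSum m f k x) h1
  have hQp : 0 < Q q (n + 1) := lt_of_lt_of_le (by positivity) (mul_le_Q hq (n + 1))
  have h3 : ‖tMean m q f (n + 1) x‖ ≤ 2 * C * B := by
    rw [tMean, norm_mul, norm_inv, Complex.norm_real, Real.norm_of_nonneg hQp.le,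
      inv_mul_le_iff₀ hQp]
    refine h2.trans ?_
    calc 2 * ((n + 1) * q n) * B ≤ 2 * (C * Q q (n + 1)) * B :=
          mul_le_mul_of_nonneg_right (mul_le_mul_of_nonneg_left (hC n) (by norm_num)) hB0
      _ = _ := by ring
  rw [← hBE, ← ofReal_norm, ← ENNReal.ofReal_coe_nnreal, ← ENNReal.ofReal_mul (by positivity)]
  refine ENNReal.ofReal_le_ofReal (h3.trans (le_of_eq ?_))
  push_cast
  ring

theorem exists_le_mul_two_pow_sq {δ : ℝ≥0} (hδ : 0 < δ) (C : ℝ≥0) :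
    ∃ K : ℕ, C ≤ (δ * 2 ^ K) ^ 2 := by
  obtain ⟨K, hK⟩ := pow_unbounded_of_one_lt (C / δ ^ 2) (one_lt_two : (1 : ℝ≥0) < 2)
  refine ⟨K, ?_⟩
  rw [div_lt_iff₀ (by positivity)] at hK
  refine hK.le.trans ?_
  rw [mul_pow, mul_comm]
  refine mul_le_mul_right ?_ _
  rw [← pow_mul]
  exact pow_le_pow_right₀ one_le_two (by omega)

theorem haar_tMax_le (hm : ∀ k, 2 ≤ m k) {b : ℕ} (hb : ∀ k, m k ≤ b)
    (hf : Martingale f (filtration m) (haar m)) {q : ℕ → ℝ} (hq : Monotone q) (hq0 : 0 < q 0)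
    {C : ℝ≥0} (hC : ∀ n : ℕ, (n + 1) * q n ≤ C * Q q (n + 1)) {δ : ℝ≥0} (hδ0 : 0 < δ)
    (hδ : ∫⁻ x, (⨆ n, ‖f n x‖ₑ) ^ (1 / 2 : ℝ) ∂haar m ≤ δ) {r : ℝ≥0} (hr : 0 < r) :
    r * haar m {x | (r : ℝ≥0∞) ^ 2 < tMax m q f x} ≤
      (((1 + 2 * C) * (5 * (5 * b ^ 2 + 20000 * b ^ 3) : ℕ) : ℝ≥0) : ℝ≥0∞) * δ := by
  set D : ℝ≥0 := 1 + 2 * C with hD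
  -- With `D ≥ 1` one has `2 C ≤ D ≤ D²`, so the factor `2 C` can be absorbed by replacing `r` with
  -- `r / D`.
  have hD1 : 1 ≤ D := le_add_of_nonneg_right zero_le
  have hD0 : 0 < D := lt_of_lt_of_le one_pos hD1
  have hset : {x | (r : ℝ≥0∞) ^ 2 < tMax m q f x} =
      ⋃ L, {x | ∃ n ≤ M m L, (r : ℝ≥0∞) ^ 2 < ‖tMean m q f n x‖ₑ} := by
    ext x
    simp only [Set.mem_ofPred_eq, tMax, lt_iSup_iff, Set.mem_iUnion]
    constructor
    · rintro ⟨n, hn⟩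
      exact ⟨n, n, (lt_M_self hm n).le, hn⟩
    · rintro ⟨_, n, _, hn⟩
      exact ⟨n, hn⟩
  have hmono : Monotone fun L => {x | ∃ n ≤ M m L, (r : ℝ≥0∞) ^ 2 < ‖tMean m q f n x‖ₑ} :=
    fun L L' hL x ⟨n, hn, h⟩ => ⟨n, hn.trans (M_mono hL), h⟩
  -- The supremum over all `n` is an increasing limit of those over `n ≤ M m L`; the bound for each
  -- is independent of `L` and of the number `K` of levels.
  rw [hset, hmono.measure_iUnion, ENNReal.mul_iSup]
  refine iSup_le fun L => ?_
  obtain ⟨P, hP⟩ := exists_predMax_le hf L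
  obtain ⟨K, hK⟩ := exists_le_mul_two_pow_sq hδ0 P
  have hsub : {x | ∃ n ≤ M m L, (r : ℝ≥0∞) ^ 2 < ‖tMean m q f n x‖ₑ} ⊆
      {x | ((r / D : ℝ≥0) : ℝ≥0∞) ^ 2 < fejerBound f b L K δ x} := by
    rintro x ⟨n, hn, h⟩
    have h1 := h.trans_le (enorm_tMean_le hm hb hf hq hq0 hC hδ
      (fun j hj x => (hP j hj x).trans hK) hn x)
    have h2 : ((2 * C : ℝ≥0) : ℝ≥0∞) ≤ (D : ℝ≥0∞) ^ 2 := by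
      rw [← ENNReal.coe_pow, ENNReal.coe_le_coe]
      calc 2 * C ≤ D := le_add_of_nonneg_left zero_le
        _ ≤ D ^ 2 := le_self_pow₀ hD1 (by norm_num)
    have h3 := h1.trans_le (mul_le_mul_left h2 _)
    have h4 : (r : ℝ≥0∞) ^ 2 = (D : ℝ≥0∞) ^ 2 * ((r / D : ℝ≥0) : ℝ≥0∞) ^ 2 := by
      rw [← mul_pow, ← ENNReal.coe_mul, mul_div_cancel₀ _ hD0.ne']
    rw [h4] at h3
    exact lt_of_mul_lt_mul_left h3 zero_le
  have h4 := haar_fejerBound_le hm hb hf hδ0 hδ L K (r := r / D) (by positivity)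
  calc r * haar m {x | ∃ n ≤ M m L, (r : ℝ≥0∞) ^ 2 < ‖tMean m q f n x‖ₑ}
      ≤ r * haar m {x | ((r / D : ℝ≥0) : ℝ≥0∞) ^ 2 < fejerBound f b L K δ x} :=
        mul_le_mul_right (measure_mono hsub) _
    _ = D * (((r / D : ℝ≥0) : ℝ≥0∞) *
        haar m {x | ((r / D : ℝ≥0) : ℝ≥0∞) ^ 2 < fejerBound f b L K δ x}) := by
        rw [← mul_assoc, ← ENNReal.coe_mul, mul_div_cancel₀ _ hD0.ne']
    _ ≤ D * (((5 * (5 * b ^ 2 + 20000 * b ^ 3) : ℕ) : ℝ≥0∞) * δ) := mul_le_mul_right h4 _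
    _ = _ := by
        rw [ENNReal.coe_mul, ENNReal.coe_natCast, mul_assoc]

/-- The maximal operator of the `T` means is bounded from `H_{1/2}` to weak-`L_{1/2}`. -/
theorem exists_weakNorm_tMax_le (hm : ∀ k, 2 ≤ m k) (hbdd : BddAbove (Set.range m)) {q : ℕ → ℝ}
    (hq : Monotone q) (hq0 : 0 < q 0)
    (hO : (fun n : ℕ => q (n - 1) / Q q n) =O[atTop] (fun n : ℕ => 1 / (n : ℝ))) :
    ∃ c : ℝ≥0, ∀ f : ℕ → VGroup m → ℂ, MemHardy m (1 / 2) f →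
      weakNorm m (1 / 2) (tMax m q f) ≤ (c : ℝ≥0∞) * hardyNorm m (1 / 2) f := by
  obtain ⟨b, hb'⟩ := hbdd
  have hb : ∀ k, m k ≤ b := fun k => hb' ⟨k, rfl⟩
  obtain ⟨C, hC⟩ := exists_mul_le_Q hq hq0 hO
  set A : ℝ≥0 := (1 + 2 * C) * (5 * (5 * b ^ 2 + 20000 * b ^ 3) : ℕ) with hA
  refine ⟨A ^ (1 / (1 / 2) : ℝ), fun f hf => ?_⟩
  set I := ∫⁻ x, (⨆ n, ‖f n x‖ₑ) ^ (1 / 2 : ℝ) ∂haar m with hI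
  have hItop : I ≠ ∞ := by
    intro h
    have h1 := hf.2
    rw [hardyNorm, ← hI, h, ENNReal.top_rpow_of_pos (by norm_num)] at h1
    exact lt_irrefl _ h1
  have key : ∀ r : ℝ≥0, 0 < r → r * haar m {x | (r : ℝ≥0∞) ^ 2 < tMax m q f x} ≤ A * I := by
    intro r hr
    refine ENNReal.le_of_forall_pos_le_add fun ε hε _ => ?_
    have hε' : 0 < ε / (A + 1) := by positivity
    -- The integral may vanish, while the levels `(δ 2^k)²` exhaust the range only for `δ > 0`;
    -- hence the perturbation.
    have h := haar_tMax_le hm hb hf.1 hq hq0 hC (δ := I.toNNReal + ε / (A + 1))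
      (by positivity) (by rw [ENNReal.coe_add, ENNReal.coe_toNNReal hItop]; exact le_self_add) hr
    refine h.trans ?_
    rw [ENNReal.coe_add, ENNReal.coe_toNNReal hItop, mul_add]
    refine add_le_add_right ?_ _
    rw [← ENNReal.coe_mul, ENNReal.coe_le_coe]
    calc A * (ε / (A + 1)) ≤ (A + 1) * (ε / (A + 1)) :=
          mul_le_mul_left (le_add_of_nonneg_right zero_le) _
      _ = ε := mul_div_cancel₀ _ (by positivity)
  rw [weakNorm, hardyNorm, ENNReal.coe_rpow_of_nonneg _ (by norm_num),
    ← ENNReal.mul_rpow_of_nonneg _ _ (by norm_num)]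
  refine ENNReal.rpow_le_rpow (iSup₂_le fun t ht => ?_) (by norm_num)
  have h1 : (t : ℝ≥0∞) ^ (1 / 2 : ℝ) = (NNReal.sqrt t : ℝ≥0) := by
    rw [NNReal.sqrt_eq_rpow, ENNReal.coe_rpow_of_nonneg _ (by norm_num)]
  have h2 : (t : ℝ≥0∞) = ((NNReal.sqrt t : ℝ≥0) : ℝ≥0∞) ^ 2 := by
    rw [← ENNReal.coe_pow, NNReal.sq_sqrt]
  rw [h1]
  have h3 := key _ (NNReal.sqrt_pos.2 ht)
  rwa [← h2] at h3

end TMeans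

/-! ### The counterexample for `p < 1/2` -/

section Divergence

variable {m : ℕ → ℕ} [∀ k, NeZero (m k)]

theorem dirichlet_M_succ (hm : ∀ k, 2 ≤ m k) (n : ℕ) (z : VGroup m) :
    dirichlet m (M m (n + 1)) z =
      (if z n = 0 then (m n : ℂ) else 0) * dirichlet m (M m n) z := by
  rw [M_succ, mul_comm, dirichlet_mul_M hm, Finset.sum_congr rfl
    (fun d hd => psi_mul_M hm (Finset.mem_range.1 hd) z), sum_rademacher_pow]

theorem sum_update_dirichlet_M_succ_sub (hm : ∀ k, 2 ≤ m k) (n : ℕ) (x : VGroup m) :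
    ∑ a : ZMod (m n), (dirichlet m (M m (n + 1)) (Function.update x n a) -
      dirichlet m (M m n) (Function.update x n a)) = 0 := by
  simp_rw [dirichlet_M_succ hm, dependsOn_update (dependsOn_dirichlet hm le_rfl),
    Function.update_self]
  rw [Finset.sum_sub_distrib, ← Finset.sum_mul]
  simp [ZMod.card]

theorem norm_dirichlet_M_succ_sub_le (hm : ∀ k, 2 ≤ m k) (n : ℕ) (z : VGroup m) :
    ‖dirichlet m (M m (n + 1)) z - dirichlet m (M m n) z‖ ≤
      (interval m n 0).indicator (fun _ => (m n * M m n : ℝ)) z := by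
  have hmn : (1 : ℝ) ≤ m n := by exact_mod_cast (by have := hm n; omega : 1 ≤ m n)
  have h1 : ‖(if z n = 0 then (m n : ℂ) else 0) - 1‖ ≤ m n := by
    split_ifs
    · have e : (m n : ℂ) - 1 = ((m n - 1 : ℝ) : ℂ) := by push_cast; rfl
      rw [e, Complex.norm_real, Real.norm_of_nonneg (by linarith)]
      linarith
    · simpa using hmn
  rw [dirichlet_M_succ hm, ← sub_one_mul, norm_mul, dirichlet_M hm]
  by_cases hz : z ∈ interval m n 0
  · rw [Set.indicator_of_mem hz, Set.indicator_of_mem hz, Complex.norm_natCast]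
    gcongr
  · rw [Set.indicator_of_notMem hz, Set.indicator_of_notMem hz, norm_zero, mul_zero]

theorem psi_apply_zero (n : ℕ) : psi m n 0 = 1 := by
  simp [psi, rademacher_eq_one_of_eq_zero]

theorem integral_dirichlet_M_mul_conj_psi_of_lt (hm : ∀ k, 2 ≤ m k) {n i : ℕ} (h : i < M m n) :
    ∫ x, dirichlet m (M m n) x * (starRingEnd ℂ) (psi m i x) ∂haar m = 1 := by
  have e : (fun x => dirichlet m (M m n) x * (starRingEnd ℂ) (psi m i x)) =
      (interval m n 0).indicator fun _ => (M m n : ℂ) := by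
    ext x
    rw [dirichlet_M hm]
    by_cases hx : x ∈ interval m n 0
    · rw [Set.indicator_of_mem hx, dependsOn_psi hm h (y := 0) fun k hk => hx k hk,
        psi_apply_zero]
      simp
    · rw [Set.indicator_of_notMem hx, zero_mul]
  have hM : (M m n : ℂ) ≠ 0 := by exact_mod_cast (M_pos n).ne'
  rw [e, integral_indicator_const _ (measurableSet_interval m n 0), haar_real_interval]
  simp [hM]

/-- The leading digit of `i` sits at a position `A ≥ n`, so `ψ_i` contains a nontrivial power of
`rademacher m A`, of mean zero in a coordinate on which nothing else depends. -/
theorem integral_dirichlet_M_mul_conj_psi_of_le (hm : ∀ k, 2 ≤ m k) {n i : ℕ} (h : M m n ≤ i) :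
    ∫ x, dirichlet m (M m n) x * (starRingEnd ℂ) (psi m i x) ∂haar m = 0 := by
  obtain ⟨A, hA1, hA2⟩ := exists_M_le_lt hm ((M_pos n).trans_le h)
  have hnA : n ≤ A := by
    by_contra hlt
    have := M_mono (m := m) (by omega : A + 1 ≤ n)
    omega
  set d := i / M m A with hd
  set k := i % M m A with hk
  have hkM : k < M m A := Nat.mod_lt _ (M_pos A)
  have hid : i = d * M m A + k := by rw [hd, hk, mul_comm]; exact (Nat.div_add_mod _ _).symm
  have hdm : d < m A := by
    rw [hd, Nat.div_lt_iff_lt_mul (M_pos A), mul_comm, ← M_succ]; exact hA2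
  have hd0 : d ≠ 0 := by
    have : 1 ≤ d := by rw [hd, Nat.one_le_div_iff (M_pos A)]; exact hA1
    omega
  have h1 : DependsOn (fun x => dirichlet m (M m n) x * (starRingEnd ℂ) (psi m k x))
      (Set.Iio A) := fun x y hxy => by
    simp only [dependsOn_mono hnA (dependsOn_dirichlet hm le_rfl) hxy, dependsOn_psi hm hkM hxy]
  have h2 : DependsOn (fun x => (starRingEnd ℂ) (rademacher m A x ^ d)) (Set.Iio (A + 1)) :=
    fun x y hxy => by simp only [rademacher, hxy A (by simp)]
  rw [← integral_mul_eq_zero h1 h2 fun x => by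
    rw [← map_sum, sum_rademacher_update_pow hd0 hdm, map_zero]]
  congr 1
  ext x
  rw [hid, psi_mul_M_add hm hkM, psi_mul_M hm hdm, map_mul]
  ring

/-- The martingale with Fourier coefficients `w_j` on the block from `M_j` to `M_{j+1}`. -/
def blockMartingale (w : ℕ → ℝ) (n : ℕ) (x : VGroup m) : ℂ :=
  ∑ j ∈ Finset.range n, (w j : ℂ) * (dirichlet m (M m (j + 1)) x - dirichlet m (M m j) x)

theorem dependsOn_blockMartingale (hm : ∀ k, 2 ≤ m k) (w : ℕ → ℝ) (n : ℕ) :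
    DependsOn (blockMartingale (m := m) w n) (Set.Iio n) := fun x y hxy => by
  refine Finset.sum_congr rfl fun j hj => ?_
  have hj' := Finset.mem_range.1 hj
  rw [dependsOn_mono hj' (dependsOn_dirichlet hm le_rfl) hxy,
    dependsOn_mono hj'.le (dependsOn_dirichlet hm le_rfl) hxy]

theorem martingale_blockMartingale (hm : ∀ k, 2 ≤ m k) (w : ℕ → ℝ) :
    Martingale (blockMartingale w) (filtration m) (haar m) := by
  refine martingale_of_dependsOn (dependsOn_blockMartingale hm w) fun n x => ?_
  have h : ∀ y : VGroup m, blockMartingale w (n + 1) y - blockMartingale w n y =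
      w n * (dirichlet m (M m (n + 1)) y - dirichlet m (M m n) y) := fun y => by
    rw [blockMartingale, Finset.sum_range_succ, ← blockMartingale, add_sub_cancel_left]
  simp_rw [h, ← Finset.mul_sum, sum_update_dirichlet_M_succ_sub hm, mul_zero]

theorem fourierCoeff_blockMartingale_zero (hm : ∀ k, 2 ≤ m k) (w : ℕ → ℝ) :
    fourierCoeff m (blockMartingale w) 0 = 0 := by
  rw [fourierCoeff_eq hm (martingale_blockMartingale hm w) (M_pos 0)]
  simp [blockMartingale]

theorem integrable_dirichlet_M_mul_conj_psi (hm : ∀ k, 2 ≤ m k) (n i : ℕ) :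
    Integrable (fun x => dirichlet m (M m n) x * (starRingEnd ℂ) (psi m i x)) (haar m) := by
  refine integrable_of_dependsOn (n := max n i) fun x y hxy => ?_
  simp only [dependsOn_mono (le_max_left n i) (dependsOn_dirichlet hm le_rfl) hxy,
    dependsOn_mono (le_max_right n i) (dependsOn_psi hm (lt_M_self hm i)) hxy]

theorem fourierCoeff_blockMartingale (hm : ∀ k, 2 ≤ m k) (w : ℕ → ℝ) {A i : ℕ}
    (h1 : M m A ≤ i) (h2 : i < M m (A + 1)) : fourierCoeff m (blockMartingale w) i = w A := by
  rw [fourierCoeff_eq hm (martingale_blockMartingale hm w) h2]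
  have hI := fun n => integrable_dirichlet_M_mul_conj_psi (m := m) hm n i
  have hterm : ∀ j, ∫ x, (w j : ℂ) * (dirichlet m (M m (j + 1)) x - dirichlet m (M m j) x) *
      (starRingEnd ℂ) (psi m i x) ∂haar m =
      w j * (∫ x, dirichlet m (M m (j + 1)) x * (starRingEnd ℂ) (psi m i x) ∂haar m -
        ∫ x, dirichlet m (M m j) x * (starRingEnd ℂ) (psi m i x) ∂haar m) := by
    intro j
    rw [← integral_sub (hI _) (hI _), ← integral_const_mul]
    congr 1
    ext x
    ring
  simp only [blockMartingale, Finset.sum_mul]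
  rw [integral_finsetSum]
  · simp_rw [hterm]
    rw [Finset.sum_range_succ, integral_dirichlet_M_mul_conj_psi_of_lt hm h2,
      integral_dirichlet_M_mul_conj_psi_of_le hm h1, Finset.sum_eq_zero]
    · simp
    · intro j hj
      have hj' := Finset.mem_range.1 hj
      rw [integral_dirichlet_M_mul_conj_psi_of_le hm ((M_mono hj').trans h1),
        integral_dirichlet_M_mul_conj_psi_of_le hm ((M_mono hj'.le).trans h1)]
      simp
  · intro j _
    have := ((hI (j + 1)).sub (hI j)).const_mul (w j : ℂ)
    refine this.congr (Eventually.of_forall fun x => ?_)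
    simp only [Pi.sub_apply]
    ring

theorem sum_norm_fourierCoeff_le (hm : ∀ k, 2 ≤ m k) {w : ℕ → ℝ} (hw : ∀ j, 0 ≤ w j) (A : ℕ) :
    ∑ i ∈ Finset.range (M m A), ‖fourierCoeff m (blockMartingale w) i‖ ≤
      ∑ j ∈ Finset.range A, w j * M m (j + 1) := by
  induction A with
  | zero => simp [M_zero, fourierCoeff_blockMartingale_zero hm]
  | succ A ih =>
    rw [Finset.sum_range_succ, Finset.range_eq_Ico,
      ← Finset.sum_Ico_consecutive _ (Nat.zero_le _) (M_mono (Nat.le_succ A)),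
      ← Finset.range_eq_Ico]
    refine add_le_add ih ?_
    calc _ = ∑ _i ∈ Finset.Ico (M m A) (M m (A + 1)), w A := by
          refine Finset.sum_congr rfl fun i hi => ?_
          obtain ⟨h1, h2⟩ := Finset.mem_Ico.1 hi
          rw [fourierCoeff_blockMartingale hm w h1 h2, Complex.norm_real,
            Real.norm_of_nonneg (hw A)]
      _ = ((M m (A + 1) - M m A : ℕ) : ℝ) * w A := by simp
      _ ≤ M m (A + 1) * w A := by
          have := hw A
          gcongr
          omega
      _ = _ := mul_comm _ _

theorem norm_partialSum_le (hm : ∀ k, 2 ≤ m k) {w : ℕ → ℝ} (hw : ∀ j, 0 ≤ w j) {A n : ℕ}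
    (hn : n ≤ M m A) (x : VGroup m) :
    ‖partialSum m (blockMartingale w) n x‖ ≤ ∑ j ∈ Finset.range A, w j * M m (j + 1) := by
  refine le_trans ?_ (sum_norm_fourierCoeff_le hm hw A)
  refine (norm_sum_le _ _).trans ?_
  simp only [norm_mul, norm_psi, mul_one]
  exact Finset.sum_le_sum_of_subset_of_nonneg (Finset.range_mono hn) fun _ _ _ => norm_nonneg _

/-- The index `M m A + 2` is the first whose mean sees block `A`: its last partial sum adds the
single term `w A * psi m (M m A) x`, of modulus `w A` at every point. -/
theorem le_norm_tMean_blockMartingale (hm : ∀ k, 2 ≤ m k) {w : ℕ → ℝ} (hw : ∀ j, 0 ≤ w j)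
    {q : ℕ → ℝ} (hq : Monotone q) (hq0 : 0 < q 0) (A : ℕ) (x : VGroup m) :
    w A / (3 * M m A) - ∑ j ∈ Finset.range A, w j * M m (j + 1) ≤
      ‖tMean m q (blockMartingale w) (M m A + 2) x‖ := by
  set B := ∑ j ∈ Finset.range A, w j * M m (j + 1) with hB
  set f : ℕ → VGroup m → ℂ := blockMartingale w with hf
  have hqp : ∀ n, 0 < q n := fun n => hq0.trans_le (hq (Nat.zero_le n))
  have hM1 : (1 : ℝ) ≤ M m A := by exact_mod_cast M_pos A
  have hQp : 0 < Q q (M m A + 2) := by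
    refine lt_of_lt_of_le ?_ (mul_le_Q hq (M m A + 2))
    positivity
  -- Monotonicity bounds every weight by the last one, and `M m A + 2 ≤ 3 * M m A`.
  have hQle : Q q (M m A + 2) ≤ 3 * M m A * q (M m A + 1) := by
    have h1 : Q q (M m A + 2) ≤ (M m A + 2 : ℕ) * q (M m A + 1) := by
      refine (Finset.sum_le_card_nsmul (Finset.range (M m A + 2)) q (q (M m A + 1)) fun k hk =>
        hq (by have := Finset.mem_range.1 hk; omega)).trans (le_of_eq ?_)
      simp
    refine h1.trans ?_
    have := (hqp (M m A + 1)).le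
    push_cast
    gcongr
    linarith
  set R := ∑ k ∈ Finset.range (M m A + 1), (q k : ℂ) * partialSum m f k x +
    (q (M m A + 1) : ℂ) * partialSum m f (M m A) x with hR
  have hRle : ‖R‖ ≤ Q q (M m A + 2) * B := by
    have h1 : ∀ k ∈ Finset.range (M m A + 1), ‖(q k : ℂ) * partialSum m f k x‖ ≤ q k * B := by
      intro k hk
      rw [norm_mul, Complex.norm_real, Real.norm_of_nonneg (hqp k).le]
      exact mul_le_mul_of_nonneg_left
        (norm_partialSum_le hm hw (Nat.lt_succ_iff.1 (Finset.mem_range.1 hk)) x) (hqp k).le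
    have h2 : ‖(q (M m A + 1) : ℂ) * partialSum m f (M m A) x‖ ≤ q (M m A + 1) * B := by
      rw [norm_mul, Complex.norm_real, Real.norm_of_nonneg (hqp _).le]
      exact mul_le_mul_of_nonneg_left (norm_partialSum_le hm hw le_rfl x) (hqp _).le
    refine (norm_add_le _ _).trans ((add_le_add ((norm_sum_le _ _).trans
      (Finset.sum_le_sum h1)) h2).trans (le_of_eq ?_))
    rw [← Finset.sum_mul, Q, Finset.sum_range_succ _ (M m A + 1), add_mul]
  have hsum : ∑ k ∈ Finset.range (M m A + 2), (q k : ℂ) * partialSum m f k x =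
      R + (q (M m A + 1) : ℂ) * (w A * psi m (M m A) x) := by
    rw [Finset.sum_range_succ]
    have : partialSum m f (M m A + 1) x = partialSum m f (M m A) x + w A * psi m (M m A) x := by
      rw [partialSum, Finset.sum_range_succ, ← partialSum,
        fourierCoeff_blockMartingale hm w le_rfl (M_strictMono hm (Nat.lt_succ_self A))]
    rw [this, hR]
    ring
  have hlow : q (M m A + 1) * w A - Q q (M m A + 2) * B ≤
      ‖∑ k ∈ Finset.range (M m A + 2), (q k : ℂ) * partialSum m f k x‖ := by
    rw [hsum, add_comm R]
    have h1 : ‖(q (M m A + 1) : ℂ) * (w A * psi m (M m A) x)‖ = q (M m A + 1) * w A := by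
      rw [norm_mul, norm_mul, norm_psi, mul_one, Complex.norm_real, Complex.norm_real,
        Real.norm_of_nonneg (hqp _).le, Real.norm_of_nonneg (hw A)]
    have h2 := norm_sub_le_norm_add ((q (M m A + 1) : ℂ) * (w A * psi m (M m A) x)) R
    rw [h1] at h2
    linarith
  rw [tMean, norm_mul, norm_inv, Complex.norm_real, Real.norm_of_nonneg hQp.le,
    inv_mul_eq_div, le_div_iff₀ hQp]
  refine le_trans ?_ hlow
  have h3 : w A / (3 * M m A) * Q q (M m A + 2) ≤ q (M m A + 1) * w A := by
    have := hw A
    calc w A / (3 * M m A) * Q q (M m A + 2) ≤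
        w A / (3 * M m A) * (3 * M m A * q (M m A + 1)) := by gcongr
      _ = _ := by field_simp
  linarith

theorem rpow_sum_le_sum_rpow {ι : Type*} (S : Finset ι) (a : ι → ℝ≥0∞) {p : ℝ} (hp : 0 < p)
    (hp1 : p ≤ 1) : (∑ i ∈ S, a i) ^ p ≤ ∑ i ∈ S, a i ^ p := by
  classical
  induction S using Finset.induction_on with
  | empty => simp [hp]
  | insert i S hi ih =>
    rw [Finset.sum_insert hi, Finset.sum_insert hi]
    exact (ENNReal.rpow_add_le_add_rpow _ _ hp.le hp1).trans (by gcongr)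

/-- For `p ≤ 1` the `p`-th power is subadditive, and the `j`-th increment has height at most `w_j
m_j M_j` and lives on `I_j(0)`, of measure `1 / M_j`. -/
theorem lintegral_blockMartingale_le (hm : ∀ k, 2 ≤ m k) {b : ℕ} (hb : ∀ k, m k ≤ b)
    {w : ℕ → ℝ} (hw : ∀ j, 0 ≤ w j) {p : ℝ} (hp : 0 < p) (hp1 : p ≤ 1) :
    ∫⁻ x, (⨆ n, ‖blockMartingale (m := m) w n x‖ₑ) ^ p ∂haar m ≤
      ∑' j, ENNReal.ofReal (b * (w j * M m j)) ^ p * (M m j : ℝ≥0∞)⁻¹ := by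
  have hpt : ∀ x : VGroup m, (⨆ n, ‖blockMartingale w n x‖ₑ) ^ p ≤
      ∑' j, (interval m j 0).indicator
        (fun _ => ENNReal.ofReal (b * (w j * M m j)) ^ p) x := by
    intro x
    rw [← ENNReal.le_rpow_inv_iff hp]
    refine iSup_le fun n => ?_
    rw [ENNReal.le_rpow_inv_iff hp]
    refine le_trans ?_ (ENNReal.sum_le_tsum (Finset.range n))
    refine (ENNReal.rpow_le_rpow (enorm_sum_le _ _) hp.le).trans
      ((rpow_sum_le_sum_rpow _ _ hp hp1).trans (Finset.sum_le_sum fun j _ => ?_))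
    have h1 := norm_dirichlet_M_succ_sub_le hm j x
    by_cases hx : x ∈ interval m j 0
    · rw [Set.indicator_of_mem hx] at h1 ⊢
      refine ENNReal.rpow_le_rpow ?_ hp.le
      rw [← ofReal_norm]
      refine ENNReal.ofReal_le_ofReal ?_
      rw [norm_mul, Complex.norm_real, Real.norm_of_nonneg (hw j)]
      have h2 : (m j : ℝ) ≤ b := by exact_mod_cast hb j
      have := hw j
      calc _ ≤ w j * (m j * M m j) := by gcongr
        _ ≤ w j * (b * M m j) := by gcongr
        _ = _ := by ring
    · rw [Set.indicator_of_notMem hx] at h1 ⊢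
      rw [norm_le_zero_iff.1 h1, mul_zero, enorm_zero, ENNReal.zero_rpow_of_pos hp]
  refine (lintegral_mono hpt).trans (le_of_eq ?_)
  rw [lintegral_tsum fun j =>
    (measurable_const.indicator (measurableSet_interval m j 0)).aemeasurable]
  refine tsum_congr fun j => ?_
  rw [lintegral_indicator_const (measurableSet_interval m j 0), haar_interval]

theorem le_weakNorm {p : ℝ} (hp : 0 < p) {g : VGroup m → ℝ≥0∞} {t : ℝ≥0} (ht : 0 < t)
    (h : ∀ x, (t : ℝ≥0∞) < g x) : (t : ℝ≥0∞) ≤ weakNorm m p g := by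
  rw [weakNorm, one_div, ENNReal.le_rpow_inv_iff hp]
  refine le_trans ?_ (le_iSup₂ t ht)
  have : {x | (t : ℝ≥0∞) < g x} = Set.univ := Set.eq_univ_of_forall h
  rw [this, measure_univ, mul_one]

/-- The expression is a positive constant times `M_n^{1/p-2}`, whose exponent is positive exactly
because `p < 1/2`. -/
theorem tendsto_rpow_M_div (hm : ∀ k, 2 ≤ m k) {p : ℝ} (hp : 0 < p) (hp2 : p < 1 / 2)
    {c : ℝ} (hc : 0 < c) :
    Tendsto (fun n => (M m n / c) ^ (1 / p) / M m n / (3 * M m n : ℝ)) atTop atTop := by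
  have h2p : 0 < 1 / p - 2 := by
    rw [sub_pos, lt_div_iff₀ hp]
    linarith
  have hM : Tendsto (fun n => (M m n : ℝ)) atTop atTop :=
    tendsto_natCast_atTop_atTop.comp (M_strictMono hm).tendsto_atTop
  have h := ((tendsto_rpow_atTop h2p).comp hM).const_mul_atTop
    (by positivity : 0 < (3 * c ^ (1 / p))⁻¹)
  refine h.congr fun n => ?_
  have hMn : (0 : ℝ) < M m n := by exact_mod_cast M_pos n
  have hcp : 0 < c ^ (1 / p) := Real.rpow_pos_of_pos hc _
  simp only [Function.comp_apply]
  rw [Real.div_rpow hMn.le hc.le, Real.rpow_sub hMn, Real.rpow_two]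
  field_simp

/-- For `p < 1/2` there is a martingale in `H_p` whose `T` means are unbounded in weak-`L_p`. -/
theorem exists_memHardy_iSup_weakNorm_tMean_eq_top (hm : ∀ k, 2 ≤ m k)
    (hbdd : BddAbove (Set.range m)) {p : ℝ} (hp : 0 < p) (hp2 : p < 1 / 2) {q : ℕ → ℝ}
    (hq : Monotone q) (hq0 : 0 < q 0) :
    ∃ f : ℕ → VGroup m → ℂ, MemHardy m p f ∧
      (⨆ n : ℕ, weakNorm m p (fun x => ‖tMean m q f n x‖ₑ)) = ∞ := by
  obtain ⟨b, hb'⟩ := hbdd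
  have hb : ∀ k, m k ≤ b := fun k => hb' ⟨k, rfl⟩
  -- Normalised so that `(v k n * M m n)^p / M m n = 2^{-k}`: the `k`-th chosen block contributes a
  -- geometric term to the `H_p` integral.
  set v : ℕ → ℕ → ℝ := fun k n => (M m n / 2 ^ k) ^ (1 / p) / M m n with hv
  -- Bounds the earlier blocks through `v 0`, which dominates `w`, so the next index can be chosen
  -- before `w` is defined.
  set H : ℕ → ℝ := fun a => ∑ j ∈ Finset.range a, v 0 j * M m (j + 1) with hH
  have hstep : ∀ k a : ℕ, ∃ n, a < n ∧ k + 2 + H (a + 1) ≤ v (k + 1) n / (3 * M m n : ℝ) := by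
    intro k a
    have h1 := (tendsto_rpow_M_div hm hp hp2
      (by positivity : (0 : ℝ) < 2 ^ (k + 1))).eventually_ge_atTop (k + 2 + H (a + 1))
    exact ((eventually_gt_atTop a).and h1).exists
  choose φ hφ1 hφ2 using hstep
  obtain ⟨α, hαs⟩ : ∃ α : ℕ → ℕ, ∀ k, α (k + 1) = φ k (α k) :=
    ⟨fun n => Nat.rec 0 φ n, fun _ => rfl⟩
  have hαm : StrictMono α := strictMono_nat_of_lt_succ fun k => by
    rw [hαs]; exact hφ1 k (α k)
  set w : ℕ → ℝ := Function.extend α (fun k => v k (α k)) 0 with hwdef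
  have hwα : ∀ k, w (α k) = v k (α k) := fun k => hαm.injective.extend_apply _ _ k
  have hw0 : ∀ j, (∀ k, α k ≠ j) → w j = 0 := fun j hj =>
    Function.extend_apply' _ _ _ fun ⟨k, hk⟩ => hj k hk
  have hv0 : ∀ k n, 0 ≤ v k n := fun k n => by simp only [hv]; positivity
  have hw : ∀ j, 0 ≤ w j := by
    intro j
    by_cases h : ∃ k, α k = j
    · obtain ⟨k, rfl⟩ := h
      rw [hwα]
      exact hv0 _ _
    · push Not at h
      exact (hw0 j h).ge
  have hwv : ∀ j, w j ≤ v 0 j := by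
    intro j
    by_cases h : ∃ k, α k = j
    · obtain ⟨k, rfl⟩ := h
      rw [hwα]
      simp only [hv]
      gcongr
      · norm_num
      · omega
    · push Not at h
      rw [hw0 j h]
      exact hv0 _ _
  have htail : ∀ k, ∑ j ∈ Finset.range (α (k + 1)), w j * M m (j + 1) ≤ H (α k + 1) := by
    intro k
    rw [← Finset.sum_subset (Finset.range_mono (hαm (Nat.lt_succ_self k)))]
    · refine Finset.sum_le_sum fun j _ => ?_
      have := hwv j
      gcongr
    · intro j hj1 hj2
      have h1 := Finset.mem_range.1 hj1
      have h2 : α k + 1 ≤ j := by simpa using hj2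
      rw [hw0 j, zero_mul]
      rintro i rfl
      have h3 := hαm.lt_iff_lt.1 h1
      have h4 : k < i := hαm.lt_iff_lt.1 (by omega)
      omega
  refine ⟨blockMartingale w, ⟨martingale_blockMartingale hm w, ?_⟩, ?_⟩
  · rw [hardyNorm]
    refine ENNReal.rpow_lt_top_of_nonneg (by positivity) (ne_of_lt ?_)
    refine (lintegral_blockMartingale_le hm hb hw hp (by linarith)).trans_lt ?_
    have hsupp : Function.support (fun j => ENNReal.ofReal (b * (w j * M m j)) ^ p *
        (M m j : ℝ≥0∞)⁻¹) ⊆ Set.range α := by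
      intro j hj
      by_contra hcon
      refine hj ?_
      simp only
      rw [hw0 j fun k hk => hcon ⟨k, hk⟩]
      simp [hp]
    rw [← hαm.injective.tsum_eq hsupp]
    have hterm : ∀ k, ENNReal.ofReal (b * (w (α k) * M m (α k))) ^ p * (M m (α k) : ℝ≥0∞)⁻¹ =
        ENNReal.ofReal ((b : ℝ) ^ p) * 2⁻¹ ^ k := by
      intro k
      have hM : (0 : ℝ) < M m (α k) := by exact_mod_cast M_pos (α k)
      have e : (b : ℝ) * (w (α k) * M m (α k)) = b * (M m (α k) / 2 ^ k) ^ (1 / p) := by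
        rw [hwα]
        simp only [hv]
        field_simp
      rw [e, ENNReal.ofReal_rpow_of_nonneg (by positivity) hp.le,
        Real.mul_rpow (by positivity) (by positivity), ← Real.rpow_mul (by positivity),
        one_div_mul_cancel hp.ne', Real.rpow_one, ENNReal.ofReal_mul (by positivity), mul_assoc]
      congr 1
      rw [ENNReal.ofReal_div_of_pos (by positivity), ENNReal.ofReal_natCast,
        ENNReal.ofReal_pow (by norm_num), ENNReal.ofReal_ofNat, div_eq_mul_inv, mul_right_comm,
        ENNReal.mul_inv_cancel (by exact_mod_cast (M_pos (α k)).ne') (by simp), one_mul,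
        ENNReal.inv_pow]
    simp_rw [hterm]
    rw [ENNReal.tsum_mul_left, ENNReal.tsum_geometric, ENNReal.one_sub_inv_two, inv_inv]
    exact ENNReal.mul_lt_top ENNReal.ofReal_lt_top (by norm_num)
  · refine ENNReal.eq_top_of_forall_nnreal_le fun r => ?_
    obtain ⟨k, hk⟩ := exists_nat_ge r
    -- At this index the mean has modulus at least `k + 2` everywhere, so its weak norm is at least
    -- `k + 1`.
    refine le_trans ?_ (le_iSup _ (M m (α (k + 1)) + 2))
    refine le_trans ?_ (le_weakNorm hp (t := k + 1) (by positivity) fun x => ?_)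
    · rw [ENNReal.coe_le_coe]
      exact hk.trans (le_add_of_nonneg_right zero_le)
    · have h1 := le_norm_tMean_blockMartingale hm hw hq hq0 (α (k + 1)) x
      have h2 := htail k
      have h3 := hφ2 k (α k)
      rw [← hαs] at h3
      rw [hwα] at h1
      rw [← ofReal_norm, ← ENNReal.ofReal_coe_nnreal]
      refine (ENNReal.ofReal_lt_ofReal_iff_of_nonneg (by positivity)).2 ?_
      push_cast
      linarith

end Divergence

end Vilenkin

end

theorem theorem2 (m : ℕ → ℕ) [∀ k, NeZero (m k)] (hm : ∀ k, 2 ≤ m k)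
    (hbdd : BddAbove (Set.range m)) :
    (∀ q : ℕ → ℝ, Monotone q → 0 < q 0 →
      (fun n : ℕ => q (n - 1) / Vilenkin.Q q n) =O[atTop] (fun n : ℕ => 1 / (n : ℝ)) →
      ∃ c : ℝ≥0, ∀ f : ℕ → Vilenkin.VGroup m → ℂ, Vilenkin.MemHardy m (1 / 2) f →
        Vilenkin.weakNorm m (1 / 2) (Vilenkin.tMax m q f) ≤
          (c : ℝ≥0∞) * Vilenkin.hardyNorm m (1 / 2) f) ∧
    (∀ p : ℝ, 0 < p → p < 1 / 2 → ∀ q : ℕ → ℝ, Monotone q → 0 < q 0 →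
      ∃ f : ℕ → Vilenkin.VGroup m → ℂ, Vilenkin.MemHardy m p f ∧
        (⨆ n : ℕ, Vilenkin.weakNorm m p (fun x => ‖Vilenkin.tMean m q f n x‖ₑ)) = ∞) :=
  ⟨fun _ hq hq0 hO => Vilenkin.exists_weakNorm_tMax_le hm hbdd hq hq0 hO,
    fun _ hp hp2 _ hq hq0 =>
      Vilenkin.exists_memHardy_iSup_weakNorm_tMean_eq_top hm hbdd hp hp2 hq hq0⟩
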